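/- **Setting.** Let $S$ (states) and $A$ (actions) be Polish spaces with their Borel $\sigma$-algebras, let $A(x)\subseteq A$ be Borel for each $x\in S$, and let $K=\{(x,a): x\in S,\ a\in A(x)\}$ be Borel in $S\times A$. Let $q(\cdot|x,a)$, $(x,a)\in K$, be transition rates: $q(\cdot|x,a)$ is a finite signed measure on $S$, $q(D|\cdot)$ is measurable on $K$ for every Borel $D$, $q(D|x,a)\ge 0$ if $x\notin D$, $q(S|x,a)=0$, and $\sup_{a\in A(x)}|q(\{x\}|x,a)|<\infty$ for every $x\in S$. Let $r,c_1,\dots,c_N:K\to\mathbb R$ be measurable (reward and costs) and put $c_0:=-r$. Let $x_\infty,a_\infty$ be isolated points added to $S$ and $A$, with $A(x_\infty):=\{a_\infty\}$ and $q(\cdot|x_\infty,a_\infty):=0$. Let $\Omega$ be the set of sequences $e=(x_0,\theta_1,x_1,\theta_2,x_2,\dots)$ with $x_0\in S$ such that either all $(\theta_k,x_k)$, $k\ge1$, lie in $(0,\infty)\times S$, or this holds up to some (possibly zero) index and all later pairs equal $(\infty,x_\infty)$. Put $T_k=\theta_1+\dots+\theta_k$, $T_\infty=\lim_k T_k$;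 let $\xi_t=x_k$ for $T_k\le t<T_{k+1}$ and $\xi_t=x_\infty$ for $t\ge T_\infty$; let $\xi_{0-}=x_0$, and, for $t>0$, $\xi_{t-}=x_k$ for $T_k<t\le T_{k+1}$ and $\xi_{t-}=x_\infty$ for $t\ge T_\infty$. Let $\mathcal F_t$ be the $\sigma$-algebra generated by the marked point process $\sum_k I_{\{T_k<\infty\}}\delta_{(T_k,x_k)}$ on $[0,t]\times S$. A *policy* is a transition probability $\pi(da|e,t)$ from $\Omega\times[0,\infty)$, with the predictable $\sigma$-algebra of $(\mathcal F_t)$, to $A\cup\{a_\infty\}$, with $\pi(A(\xi_{t-}(e))|e,t)=1$ for all $(e,t)$. For a history $h_k=(x_0,\theta_1,x_1,\dots,\theta_k,x_k)$ with $T_k<\infty$, and $s>0$, let $m_k(D|h_k,s)=\int \pi(da|e,T_k+s)\,q(D\setminus\{x_k\}|x_k,a)$, where $e$ is any path that follows $h_k$ and has $\theta_{k+1}\ge s$. Let $P_x^\pi$ be the probability measure on $\Omega$ with $x_0=x$ under which, given $h_k$, $(\theta_{k+1},x_{k+1})$ has the law $$e^{-\int_0^{s}m_k(S|h_k,v)\,dv}\,m_k(dy|h_k,s)\,ds\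 \text{ on }(0,\infty)\times S,\qquad e^{-\int_0^\infty m_k(S|h_k,v)\,dv}\ \text{ at }(\infty,x_\infty).$$ Write $E_x^\pi$ for its expectation. Functions on $K$ and on $S$ are extended by $0$. For $\alpha>0$ and a probability measure $\gamma$ on $S$ put, for $n=0,\dots,N$, $$V_n(x,\pi)=\int_0^\infty e^{-\alpha t}E_x^\pi\Big[\int c_n(\xi_{t-},a)\,\pi(da|e,t)\Big]dt,\qquad V_n(\pi)=\int_S V_n(x,\pi)\,\gamma(dx).$$ **Assumption A.** $w\ge1$ is a continuous function on $S$, $\rho,b\ge0$ are constants and $S_1\subseteq S_2\subseteq\cdots$ are subsets of $S$ such that (1) $w$ is integrable with respect to $q(\cdot|x,a)$ and $\int_S w(y)\,q(dy|x,a)\le\rho w(x)+b$ for all $(x,a)\in K$; (2) $\inf_{x\notin S_k}w(x)\uparrow\infty$ (with $\inf\varnothing=\infty$); (3) $\bigcup_kS_k=S$ and $\sup_{x\in S_k,a\in A(x)}|q(\{x\}|x,a)|<\infty$ for every $k$. **Assumption B.** (1) $M>0$ and $|c_n(x,a)|\le Mw(x)$ for all $(x,a)\in K$, $n=0,\dots,N$;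 (2) $\alpha>\rho$; (3) $\int_S w\,d\gamma<\infty$. **Theorem.** Under Assumptions A and B, for every policy $\pi$, $x\in S$ and $n=0,1,\dots,N$: (a) for every $t\ge0$, $P_x^\pi$-almost surely $(\xi_t,a)\in K$ for $\pi(\cdot|e,t)$-almost every $a$ (in particular $\xi_t\in S$ almost surely), and $$E_x^\pi\Big[\int|c_n(\xi_t,a)|\,\pi(da|e,t)\Big]\le M\,E_x^\pi[w(\xi_t)]<\infty ;$$ (b) the integrals defining $V_n(x,\pi)$ and $V_n(\pi)$ exist and are finite, and $$|V_n(x,\pi)|\le\frac{M[\alpha w(x)+b]}{\alpha(\alpha-\rho)},\qquad |V_n(\pi)|\le M M_1^*,\qquad M_1^*:=\frac{\alpha\int_S w\,d\gamma+b}{\alpha(\alpha-\rho)} .$$ -/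

import Mathlib

open MeasureTheory ProbabilityTheory Set Filter Topology
open scoped ENNReal NNReal

namespace CTMDP

universe u v

section Aux

theorem isSFiniteKernel_of_lt_top {α β : Type*} [MeasurableSpace α] [MeasurableSpace β]
    (κ : Kernel α β) (h : ∀ a, κ a univ < ∞) : IsSFiniteKernel κ := by
  have hf : Measurable fun a => ⌊(κ a univ).toReal⌋₊ :=
    Nat.measurable_floor.comp (κ.measurable_coe MeasurableSet.univ).ennreal_toReal
  have hs : ∀ n, MeasurableSet {a | ⌊(κ a univ).toReal⌋₊ = n} := fun n =>
    hf (measurableSet_singleton n)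
  have hk : κ = Kernel.sum fun n => Kernel.piecewise (hs n) κ 0 := by
    ext a t ht
    rw [Kernel.sum_apply' _ _ ht, tsum_eq_single ⌊(κ a univ).toReal⌋₊]
    · simp [Kernel.piecewise_apply]
    · intro n hn
      simp [Kernel.piecewise_apply, hn.symm]
  rw [hk]
  have : ∀ n, IsFiniteKernel (Kernel.piecewise (hs n) κ 0) := fun n => by
    refine ⟨⟨(n : ℝ≥0∞) + 1, by finiteness, fun a => ?_⟩⟩
    rw [Kernel.piecewise_apply]
    split_ifs with ha
    · have h1 := (Nat.lt_floor_add_one (κ a univ).toReal).le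
      rw [show ⌊(κ a univ).toReal⌋₊ = n from ha] at h1
      rw [← ENNReal.ofReal_toReal (h a).ne]
      calc ENNReal.ofReal (κ a univ).toReal ≤ ENNReal.ofReal ((n : ℝ) + 1) :=
            ENNReal.ofReal_le_ofReal h1
        _ = (n : ℝ≥0∞) + 1 := by
            rw [ENNReal.ofReal_add (by positivity) (by positivity)]; simp
    · simp
  infer_instance

/-- `exp (-x)` for `x ∈ [0, ∞]`, with `exp (-∞) = 0`. -/
noncomputable def expNeg (x : ℝ≥0∞) : ℝ≥0∞ := EReal.exp (-(x : EReal))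

theorem expNeg_eq {x : ℝ≥0∞} (hx : x ≠ ∞) :
    expNeg x = ENNReal.ofReal (Real.exp (-x.toReal)) := by
  lift x to ℝ≥0 using hx
  rfl

theorem expNeg_top : expNeg ∞ = 0 := by simp [expNeg]

theorem expNeg_ne_top (x : ℝ≥0∞) : expNeg x ≠ ∞ := by
  simp [expNeg, EReal.exp_eq_top_iff, EReal.neg_eq_top_iff]

theorem continuous_expNeg : Continuous expNeg :=
  ENNReal.continuous_exp.comp (continuous_neg.comp continuous_coe_ennreal_ereal)

theorem measurable_expNeg : Measurable expNeg := continuous_expNeg.measurable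

theorem lintegral_hazard_Icc (f : ℝ → ℝ) (C : ℝ) (hf : Measurable f) (h0 : ∀ t, 0 ≤ f t)
    (hC : ∀ t, f t ≤ C) (T : ℝ) (hT : 0 ≤ T) :
    ∫ t in (0 : ℝ)..T, f t * Real.exp (-∫ s in (0 : ℝ)..t, f s)
      = 1 - Real.exp (-∫ s in (0 : ℝ)..T, f s) := by
  have hC0 : 0 ≤ C := (h0 0).trans (hC 0)
  have hint : LocallyIntegrable f volume := by
    have : LocallyIntegrable (fun _ : ℝ => C) volume := locallyIntegrable_const C
    refine this.mono hf.aestronglyMeasurable (ae_of_all _ fun t => ?_)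
    rw [Real.norm_of_nonneg (h0 t), Real.norm_of_nonneg hC0]; exact hC t
  have hii : ∀ a b, IntervalIntegrable f volume a b := fun a b =>
    (hint.integrableOn_isCompact isCompact_uIcc).intervalIntegrable
  set F : ℝ → ℝ := fun t => ∫ s in (0 : ℝ)..t, f s with hF
  set G : ℝ → ℝ := fun t => Real.exp (-F t) with hG
  have hFL : ∀ x y, |F x - F y| ≤ C * |x - y| := fun x y => by
    have : F x - F y = ∫ s in y..x, f s := by
      rw [hF]; exact intervalIntegral.integral_interval_sub_left (hii _ _) (hii _ _)
    rw [this]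
    have := intervalIntegral.norm_integral_le_of_norm_le_const (a := y) (b := x) (f := f) (C := C)
      (fun t _ => by rw [Real.norm_of_nonneg (h0 t)]; exact hC t)
    simpa using this
  have hFnn : ∀ t, 0 ≤ t → 0 ≤ F t := fun t ht =>
    intervalIntegral.integral_nonneg ht fun s _ => h0 s
  have hGlip : LipschitzOnWith C.toNNReal G (uIcc 0 T) := by
    refine LipschitzOnWith.of_dist_le_mul fun x hx y hy => ?_
    rw [uIcc_of_le hT] at hx hy
    rw [Real.coe_toNNReal _ hC0, Real.dist_eq, Real.dist_eq]
    refine le_trans ?_ (hFL x y)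
    have key : ∀ a b : ℝ, 0 ≤ a → 0 ≤ b → a ≤ b →
        |Real.exp (-a) - Real.exp (-b)| ≤ |a - b| := by
      intro a b ha hb hab
      rw [abs_of_nonneg (by simpa using hab), abs_sub_comm, abs_of_nonneg (by linarith)]
      have h1 := Real.add_one_le_exp (a - b)
      have h2 : Real.exp (-b) = Real.exp (-a) * Real.exp (a - b) := by
        rw [← Real.exp_add]; ring_nf
      have h3 : Real.exp (-a) ≤ 1 := Real.exp_le_one_iff.2 (by linarith)
      have h4 := Real.exp_pos (-a)
      rw [h2]
      nlinarith
    rcases le_total (F x) (F y) with h | h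
    · exact key _ _ (hFnn _ hx.1) (hFnn _ hy.1) h
    · rw [abs_sub_comm, abs_sub_comm (F x)]
      exact key _ _ (hFnn _ hy.1) (hFnn _ hx.1) h
  have hac := hGlip.absolutelyContinuousOnInterval.integral_deriv_eq_sub
  have hd : ∫ t in (0 : ℝ)..T, deriv G t = ∫ t in (0 : ℝ)..T, -(f t * G t) := by
    refine intervalIntegral.integral_congr_ae ?_
    filter_upwards [LocallyIntegrable.ae_hasDerivAt_integral hint] with t ht _
    have := ((ht 0).neg.exp).deriv
    rw [show deriv G t = _ from this]
    simp only [hG, hF, Pi.neg_apply]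
    ring
  rw [hd, intervalIntegral.integral_neg] at hac
  have hG0 : G 0 = 1 := by simp [hG, hF]
  rw [hG0] at hac
  linarith

/-- Lebesgue measure on `(0, ∞)`. -/
noncomputable def posLebesgue : Measure (Ioi (0 : ℝ)) := Measure.comap Subtype.val volume

instance : SFinite posLebesgue := by
  have h1 : LocallyCompactSpace (Ioi (0 : ℝ)) := isOpen_Ioi.locallyCompactSpace
  have h2 : IsFiniteMeasureOnCompacts posLebesgue :=
    .comap' _ continuous_subtype_val (MeasurableEmbedding.subtype_coe measurableSet_Ioi)
  infer_instance

/-- A bounded hazard rate `f` defines a (possibly defective) waiting time: the density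
`f(t) exp (-∫₀ᵗ f)` on `(0, ∞)` and the mass `exp (-∫₀^∞ f)` at infinity add up to `1`. -/
theorem lintegral_hazard (f : Ioi (0 : ℝ) → ℝ≥0∞) (C : ℝ≥0) (hf : Measurable f)
    (hC : ∀ t, f t ≤ C) :
    (∫⁻ t, expNeg (∫⁻ s in Iic t, f s ∂posLebesgue) * f t ∂posLebesgue)
      + expNeg (∫⁻ s, f s ∂posLebesgue) = 1 := by
  have hfin : ∀ t, f t ≠ ∞ := fun t => ((hC t).trans_lt ENNReal.coe_lt_top).ne
  set g : ℝ → ℝ := Function.extend (↑) (fun t : Ioi (0 : ℝ) => (f t).toReal) 0 with hgdef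
  have hg : Measurable g :=
    (MeasurableEmbedding.subtype_coe measurableSet_Ioi).measurable_extend hf.ennreal_toReal
      measurable_const
  have hgval : ∀ t : Ioi (0 : ℝ), g t = (f t).toReal := fun t =>
    Subtype.val_injective.extend_apply _ _ t
  have hgcase : ∀ t, 0 ≤ g t ∧ g t ≤ C := fun t => by
    by_cases ht : 0 < t
    · have := hgval ⟨t, ht⟩
      rw [show g t = _ from this]
      exact ⟨ENNReal.toReal_nonneg, ENNReal.toReal_le_coe_of_le_coe (hC _)⟩
    · have : g t = 0 := Function.extend_apply' _ _ _ (by rintro ⟨s, rfl⟩; exact ht s.2)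
      rw [this]; exact ⟨le_rfl, C.2⟩
  have hfg : ∀ t : Ioi (0 : ℝ), f t = ENNReal.ofReal (g t) := fun t => by
    rw [hgval, ENNReal.ofReal_toReal (hfin t)]
  have hint : LocallyIntegrable g volume := by
    refine (locallyIntegrable_const (C : ℝ)).mono hg.aestronglyMeasurable
      (ae_of_all _ fun t => ?_)
    rw [Real.norm_of_nonneg (hgcase t).1, Real.norm_of_nonneg (NNReal.coe_nonneg C)]
    exact (hgcase t).2
  have hgi : ∀ a b, IntegrableOn g (Ioc a b) volume := fun a b =>
    (hint.integrableOn_isCompact isCompact_Icc).mono_set Ioc_subset_Icc_self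
  set F : ℝ → ℝ := fun t => ∫ s in (0 : ℝ)..t, g s with hF
  have hFc : Continuous F := intervalIntegral.continuous_primitive
    (fun a b => (hint.integrableOn_isCompact isCompact_uIcc).intervalIntegrable) 0
  have hFI : ∀ t, 0 ≤ t → ∫⁻ s in Ioc 0 t, ENNReal.ofReal (g s) = ENNReal.ofReal (F t) :=
    fun t ht => by
      rw [hF]; simp only
      rw [intervalIntegral.integral_of_le ht,
        ofReal_integral_eq_lintegral_ofReal (hgi 0 t) (ae_of_all _ fun s => (hgcase s).1)]
  have hFnn : ∀ t, 0 ≤ t → 0 ≤ F t := fun t ht =>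
    intervalIntegral.integral_nonneg ht fun s _ => (hgcase s).1
  have hL : ∀ t : Ioi (0 : ℝ), ∫⁻ s in Iic t, f s ∂posLebesgue = ENNReal.ofReal (F t) :=
    fun t => by
      have him : ((↑) : Ioi (0 : ℝ) → ℝ) '' Iic t = Ioc 0 (t : ℝ) := by
        ext s; constructor
        · rintro ⟨u, hu, rfl⟩; exact ⟨u.2, hu⟩
        · intro hs; exact ⟨⟨s, hs.1⟩, hs.2, rfl⟩
      simp_rw [hfg]
      rw [posLebesgue, setLIntegral_subtype measurableSet_Ioi _ fun s => ENNReal.ofReal (g s), him,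
        hFI _ (le_of_lt t.2)]
  have hun : Ioi (0 : ℝ) = ⋃ n : ℕ, Ioc (0 : ℝ) n := by
    ext s; simp only [mem_Ioi, mem_iUnion, mem_Ioc]
    constructor
    · intro hs; obtain ⟨n, hn⟩ := exists_nat_ge s; exact ⟨n, hs, hn⟩
    · rintro ⟨n, hn, _⟩; exact hn
  have hmono : Monotone fun n : ℕ => Ioc (0 : ℝ) n := fun m n hmn =>
    Ioc_subset_Ioc_right (by exact_mod_cast hmn)
  have hlim : ∀ h : ℝ → ℝ≥0∞, Tendsto (fun n : ℕ => ∫⁻ s in Ioc (0 : ℝ) n, h s) atTop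
      (𝓝 (∫⁻ s in Ioi (0 : ℝ), h s)) := fun h => by
    rw [hun, setLIntegral_iUnion_of_directed h (directed_of_isDirected_le hmono)]
    exact tendsto_atTop_iSup fun m n hmn => lintegral_mono_set (hmono hmn)
  have e1 : ∫⁻ t, expNeg (∫⁻ s in Iic t, f s ∂posLebesgue) * f t ∂posLebesgue
      = ∫⁻ t in Ioi (0 : ℝ), ENNReal.ofReal (g t * Real.exp (-F t)) := by
    rw [← lintegral_subtype_comap measurableSet_Ioi fun t => ENNReal.ofReal (g t * Real.exp (-F t)),
      ← posLebesgue]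
    refine lintegral_congr fun t => ?_
    rw [hL, expNeg_eq ENNReal.ofReal_ne_top, hfg, ENNReal.toReal_ofReal (hFnn _ (le_of_lt t.2)),
      ENNReal.ofReal_mul (hgcase t).1, mul_comm]
  have e2 : ∫⁻ s, f s ∂posLebesgue = ∫⁻ t in Ioi (0 : ℝ), ENNReal.ofReal (g t) := by
    simp_rw [hfg]
    rw [posLebesgue, lintegral_subtype_comap measurableSet_Ioi fun s => ENNReal.ofReal (g s)]
  rw [e1, e2]
  have hsum : ∀ n : ℕ, (∫⁻ t in Ioc (0 : ℝ) n, ENNReal.ofReal (g t * Real.exp (-F t)))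
      + expNeg (∫⁻ t in Ioc (0 : ℝ) n, ENNReal.ofReal (g t)) = 1 := fun n => by
    have hn : (0 : ℝ) ≤ n := n.cast_nonneg
    have hgF : IntegrableOn (fun t => g t * Real.exp (-F t)) (Ioc 0 (n : ℝ)) volume :=
      ((hint.integrableOn_isCompact isCompact_Icc).mul_continuousOn
        (Real.continuous_exp.comp hFc.neg).continuousOn isCompact_Icc).mono_set Ioc_subset_Icc_self
    rw [hFI _ hn, expNeg_eq ENNReal.ofReal_ne_top, ENNReal.toReal_ofReal (hFnn _ hn),
      ← ofReal_integral_eq_lintegral_ofReal hgF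
        (ae_of_all _ fun s => mul_nonneg (hgcase s).1 (Real.exp_pos _).le),
      ← intervalIntegral.integral_of_le hn,
      lintegral_hazard_Icc g C hg (fun t => (hgcase t).1) (fun t => (hgcase t).2) n hn,
      ← ENNReal.ofReal_add _ (Real.exp_pos _).le]
    · simp [hF]
    · have : Real.exp (-F n) ≤ 1 := Real.exp_le_one_iff.2 (by linarith [hFnn n hn])
      linarith
  have hT := (hlim fun t => ENNReal.ofReal (g t * Real.exp (-F t))).add
    ((continuous_expNeg.tendsto _).comp (hlim fun t => ENNReal.ofReal (g t)))
  exact tendsto_nhds_unique hT (by simp only [Function.comp_def, hsum]; exact tendsto_const_nhds)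

end Aux

section Definitions

variable {S : Type u} {A : Type v} [MeasurableSpace S] [MeasurableSpace A] {N : ℕ}

/-- A constrained continuous-time Markov decision model
`{S, (A(x)), q(·|x,a), r(x,a), (c_n(x,a), d_n)}`. The functions `q`, `r`, `c_n` live on the
set `K = {(x,a) | a ∈ A(x)}` of admissible state-action pairs only. -/
structure Model (S : Type u) (A : Type v) [MeasurableSpace S] [MeasurableSpace A] (N : ℕ) where
  /-- the set `A(x)` of admissible actions -/
  adm : S → Set A
  measurableSet_adm : ∀ x, MeasurableSet (adm x)
  measurableSet_graph : MeasurableSet {z : S × A | z.2 ∈ adm z.1}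
  /-- the transition rates `q(·|x,a)` -/
  q : {z : S × A // z.2 ∈ adm z.1} → SignedMeasure S
  measurable_q : ∀ D, MeasurableSet D → Measurable fun z => q z D
  q_nonneg : ∀ z D, MeasurableSet D → z.1.1 ∉ D → 0 ≤ q z D
  q_univ : ∀ z, q z univ = 0
  stable : ∀ x, ∃ C : ℝ, ∀ z, z.1.1 = x → |q z {x}| ≤ C
  /-- the reward `r` -/
  r : {z : S × A // z.2 ∈ adm z.1} → ℝ
  measurable_r : Measurable r
  /-- the costs `c_1, …, c_N`, indexed by `0, …, N - 1` -/
  c : Fin N → {z : S × A // z.2 ∈ adm z.1} → ℝ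
  measurable_c : ∀ n, Measurable (c n)
  /-- the constraint constants `d_1, …, d_N` -/
  d : Fin N → ℝ

/-- The set `K` of admissible state-action pairs. -/
abbrev Model.K (𝓜 : Model S A N) : Type (max u v) := {z : S × A // z.2 ∈ 𝓜.adm z.1}

/-- `c_0 := -r`, followed by `c_1, …, c_N`. -/
def Model.cost (𝓜 : Model S A N) : Fin (N + 1) → 𝓜.K → ℝ := Fin.cons (fun z => -𝓜.r z) 𝓜.c

/-- The inclusion of `K` into `S_∞ × A_∞`, where `S_∞ = S ⊕ Unit` and `A_∞ = A ⊕ Unit` arise by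
adding the isolated points `x_∞ = inr ()` and `a_∞ = inr ()`. -/
def Model.incl (𝓜 : Model S A N) (z : 𝓜.K) : (S ⊕ Unit) × (A ⊕ Unit) :=
  (Sum.inl z.1.1, Sum.inl z.1.2)

/-- The set of actions `A(x) ⊆ A_∞` for `x ∈ S_∞`, with `A(x_∞) = {a_∞}`. -/
def Model.admInfty (𝓜 : Model S A N) : S ⊕ Unit → Set (A ⊕ Unit)
  | Sum.inl x => Sum.inl '' 𝓜.adm x
  | Sum.inr _ => {Sum.inr ()}

theorem Model.measurableEmbedding_incl (𝓜 : Model S A N) : MeasurableEmbedding 𝓜.incl := by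
  have hS : MeasurableEmbedding (Sum.inl : S → S ⊕ Unit) :=
    ⟨Sum.inl_injective, measurable_inl, fun _ hs => measurableSet_inl_image.2 hs⟩
  have hA : MeasurableEmbedding (Sum.inl : A → A ⊕ Unit) :=
    ⟨Sum.inl_injective, measurable_inl, fun _ hs => measurableSet_inl_image.2 hs⟩
  exact (hS.prodMap hA).comp (MeasurableEmbedding.subtype_coe 𝓜.measurableSet_graph)

/-- A function on `K`, extended by `0` to `S_∞ × A_∞`. -/
noncomputable def Model.extendZero (𝓜 : Model S A N) (u : 𝓜.K → ℝ) :
    (S ⊕ Unit) × (A ⊕ Unit) → ℝ :=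
  Function.extend 𝓜.incl u 0

theorem Model.zero_le_restrict_q (𝓜 : Model S A N) (z : 𝓜.K) : (0 : SignedMeasure S) ≤[{z.1.1}ᶜ] 𝓜.q z := by
  refine VectorMeasure.restrict_le_restrict_of_subset_le _ _ fun D hD hDx => ?_
  simpa using 𝓜.q_nonneg z D hD fun h => hDx h rfl

theorem Model.measurable_q_section (𝓜 : Model S A N) {E : Set (S × S)} (hE : MeasurableSet E) :
    Measurable fun z : 𝓜.K => 𝓜.q z (Prod.mk z.1.1 ⁻¹' E) := by
  have hmk : ∀ (x : S) {E : Set (S × S)}, MeasurableSet E → MeasurableSet (Prod.mk x ⁻¹' E) :=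
    fun x E hE => measurable_prodMk_left hE
  induction E, hE using MeasurableSpace.induction_on_inter generateFrom_prod.symm isPiSystem_prod
    with
  | empty => simp
  | basic E hE =>
    obtain ⟨B, hB, D, hD, rfl⟩ := hE
    have : (fun z : 𝓜.K => 𝓜.q z (Prod.mk z.1.1 ⁻¹' (B ×ˢ D)))
        = ((fun z : 𝓜.K => z.1.1) ⁻¹' B).indicator fun z => 𝓜.q z D := by
      classical
      funext z
      by_cases h : z.1.1 ∈ B
      · simp [h, mk_preimage_prod_right]
      · simp [h, mk_preimage_prod_right_eq_empty]
    rw [this]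
    exact (𝓜.measurable_q D hD).indicator ((measurable_fst.comp measurable_subtype_coe) hB)
  | compl E hE ih =>
    have : (fun z : 𝓜.K => 𝓜.q z (Prod.mk z.1.1 ⁻¹' Eᶜ))
        = fun z => 𝓜.q z univ - 𝓜.q z (Prod.mk z.1.1 ⁻¹' E) := by
      funext z
      have h := VectorMeasure.of_add_of_sdiff (v := 𝓜.q z) (hmk z.1.1 hE) MeasurableSet.univ
        (subset_univ _)
      rw [← compl_eq_univ_sdiff] at h
      rw [preimage_compl]
      linarith
    rw [this]
    exact (𝓜.measurable_q _ MeasurableSet.univ).sub ih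
  | iUnion f hd hf ih =>
    have hs : ∀ z : 𝓜.K, HasSum (fun i => 𝓜.q z (Prod.mk z.1.1 ⁻¹' f i))
        (𝓜.q z (Prod.mk z.1.1 ⁻¹' ⋃ i, f i)) := fun z => by
      rw [preimage_iUnion]
      exact (𝓜.q z).hasSum_of_disjoint_iUnion (fun i => hmk _ (hf i))
        fun i j hij => (hd hij).preimage _
    refine measurable_of_tendsto_metrizable (f := fun n z =>
      ∑ i ∈ Finset.range n, 𝓜.q z (Prod.mk z.1.1 ⁻¹' f i))
      (fun n => Finset.measurable_fun_sum _ fun i _ => ih i) ?_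
    rw [tendsto_pi_nhds]
    exact fun z => (hs z).tendsto_sum_nat

section Rates

variable [StandardBorelSpace S] (𝓜 : Model S A N)

/-- The measure `D ↦ q(D ∖ {x} | x, a)` for `(x, a) ∈ K`. -/
noncomputable def Model.jumpMeasureOn (z : 𝓜.K) : Measure S :=
  (𝓜.q z).toMeasureOfZeroLE {z.1.1}ᶜ (measurableSet_singleton _).compl (𝓜.zero_le_restrict_q z)

theorem Model.jumpMeasureOn_apply (z : 𝓜.K) {D : Set S} (hD : MeasurableSet D) :
    𝓜.jumpMeasureOn z D = ENNReal.ofReal (𝓜.q z (D \ {z.1.1})) := by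
  rw [jumpMeasureOn, SignedMeasure.toMeasureOfZeroLE_apply _ _ _ hD,
    ← ENNReal.ofReal_eq_coe_nnreal]
  congr 2
  rw [inter_comm, sdiff_eq]

theorem Model.measurable_jumpMeasureOn : Measurable 𝓜.jumpMeasureOn := by
  refine Measure.measurable_of_measurable_coe _ fun D hD => ?_
  simp_rw [𝓜.jumpMeasureOn_apply _ hD]
  have hE : MeasurableSet {p : S × S | p.2 ∈ D ∧ p.2 ≠ p.1} :=
    (measurable_snd hD).inter (measurableSet_eq_fun measurable_snd measurable_fst).compl
  exact (𝓜.measurable_q_section hE).ennreal_ofReal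

/-- The jump rates as a kernel from `S_∞ × A_∞` to `S`: `D ↦ q(D ∖ {x} | x, a)` for
`(x, a) ∈ K`, and `0` elsewhere, in particular at `(x_∞, a_∞)`. -/
noncomputable def Model.jumpRate : Kernel ((S ⊕ Unit) × (A ⊕ Unit)) S where
  toFun := Function.extend 𝓜.incl 𝓜.jumpMeasureOn 0
  measurable' := 𝓜.measurableEmbedding_incl.measurable_extend 𝓜.measurable_jumpMeasureOn
    measurable_const

theorem Model.jumpRate_incl (z : 𝓜.K) : 𝓜.jumpRate (𝓜.incl z) = 𝓜.jumpMeasureOn z :=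
  𝓜.measurableEmbedding_incl.injective.extend_apply _ _ z

theorem Model.jumpRate_of_notMem {p : (S ⊕ Unit) × (A ⊕ Unit)} (hp : p ∉ range 𝓜.incl) :
    𝓜.jumpRate p = 0 := Function.extend_apply' _ _ _ hp

theorem Model.jumpRate_bound (y : S ⊕ Unit) :
    ∃ C : ℝ≥0, ∀ a, 𝓜.jumpRate (y, a) univ ≤ C := by
  rcases y with x | y
  · obtain ⟨C, hC⟩ := 𝓜.stable x
    refine ⟨C.toNNReal, fun a => ?_⟩
    by_cases h : (Sum.inl x, a) ∈ range 𝓜.incl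
    · obtain ⟨z, hz⟩ := h
      have hx : z.1.1 = x := Sum.inl_injective (congrArg Prod.fst hz)
      rw [← hz, jumpRate_incl, 𝓜.jumpMeasureOn_apply z MeasurableSet.univ]
      refine ENNReal.ofReal_le_ofReal ?_
      have h1 := VectorMeasure.of_add_of_sdiff (v := 𝓜.q z) (measurableSet_singleton z.1.1)
        MeasurableSet.univ (subset_univ _)
      rw [𝓜.q_univ] at h1
      have h2 := (neg_le_abs _).trans (hC z hx)
      rw [← hx] at h2
      linarith
    · simp [𝓜.jumpRate_of_notMem h]
  · refine ⟨0, fun a => ?_⟩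
    rw [𝓜.jumpRate_of_notMem]
    · simp
    · rintro ⟨z, hz⟩
      simpa [incl] using congrArg Prod.fst hz

instance : IsSFiniteKernel 𝓜.jumpRate :=
  isSFiniteKernel_of_lt_top _ fun p => by
    obtain ⟨C, hC⟩ := 𝓜.jumpRate_bound p.1
    exact (hC p.2).trans_lt ENNReal.coe_lt_top

end Rates

section Paths

/-- The coordinates of a path: the initial state `x_0`, followed by the pairs `(θ_k, x_k)` for
`k ≥ 1`, which lie in `(0, ∞) × S` or are equal to `(∞, x_∞) = inr ()`. -/
def Coord (S : Type u) : ℕ → Type u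
  | 0 => S
  | _ + 1 => (Ioi (0 : ℝ) × S) ⊕ Unit

instance instMeasurableSpaceCoord : ∀ n, MeasurableSpace (Coord S n)
  | 0 => inferInstanceAs (MeasurableSpace S)
  | _ + 1 => inferInstanceAs (MeasurableSpace ((Ioi (0 : ℝ) × S) ⊕ Unit))

/-- The pair `(∞, x_∞)`. -/
def Coord.dead {n : ℕ} : Coord S (n + 1) := (Sum.inr () : (Ioi (0 : ℝ) × S) ⊕ Unit)

/-- The pair `(θ, x) ∈ (0, ∞) × S` as a coordinate of a path. -/
def Coord.jump {n : ℕ} (p : Ioi (0 : ℝ) × S) : Coord S (n + 1) :=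
  (Sum.inl p : (Ioi (0 : ℝ) × S) ⊕ Unit)

/-- The sample space `Ω`: all sequences `(x_0, θ_1, x_1, θ_2, x_2, …)` with `x_0 ∈ S` such that
either all `(θ_k, x_k)` lie in `(0, ∞) × S`, or this holds up to some index and all later pairs are
`(∞, x_∞)`. -/
def Path (S : Type u) : Type u :=
  {e : (n : ℕ) → Coord S n // ∀ n, e (n + 1) = Coord.dead → e (n + 2) = Coord.dead}

instance instMeasurableSpacePath : MeasurableSpace (Path S) :=
  inferInstanceAs (MeasurableSpace
    {e : (n : ℕ) → Coord S n // ∀ n, e (n + 1) = Coord.dead → e (n + 2) = Coord.dead})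

/-- The sojourn time `Θ_{k+1} ∈ (0, ∞]` in the state `X_k`. -/
noncomputable def sojourn (k : ℕ) (e : Path S) : ℝ≥0∞ :=
  Sum.elim (fun p : Ioi (0 : ℝ) × S => ENNReal.ofReal p.1) (fun _ => ∞) (e.1 (k + 1))

/-- The jump epoch `T_k = Θ_1 + ⋯ + Θ_k`. -/
noncomputable def jumpTime (k : ℕ) (e : Path S) : ℝ≥0∞ := ∑ i ∈ Finset.range k, sojourn i e

/-- The post-jump state `X_k ∈ S_∞`. -/
def jumpState : ℕ → Path S → S ⊕ Unit
  | 0, e => Sum.inl (show S from e.1 0)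
  | k + 1, e => Sum.map Prod.snd id (show (Ioi (0 : ℝ) × S) ⊕ Unit from e.1 (k + 1))

open Classical in
/-- The state process `ξ_t`: it equals `X_k` on `[T_k, T_{k+1})`, and `x_∞` from
`T_∞ = lim T_k` on. -/
noncomputable def stateAt (t : ℝ≥0) (e : Path S) : S ⊕ Unit :=
  if h : ∃ k, jumpTime k e ≤ t ∧ t < jumpTime (k + 1) e then jumpState (Nat.find h) e
  else Sum.inr ()

open Classical in
/-- The left-limit process `ξ_{t-}`: it equals `X_k` on `(T_k, T_{k+1}]` and `x_∞` on
`[T_∞, ∞)`; moreover `ξ_{0-} = x_0`. -/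
noncomputable def stateBefore (t : ℝ≥0) (e : Path S) : S ⊕ Unit :=
  if t = 0 then jumpState 0 e
  else if h : ∃ k, jumpTime k e < t ∧ t ≤ jumpTime (k + 1) e then jumpState (Nat.find h) e
  else Sum.inr ()

/-- The random measure `μ^*(dt, dx) = ∑_k I{T_k < ∞} δ_{(T_k, X_k)}(dt, dx)` on `[0, ∞) × S`. -/
noncomputable def jumpMeasure (e : Path S) : Measure (ℝ≥0 × S) :=
  Measure.sum fun k =>
    Sum.elim (fun x => if jumpTime k e < ∞ then Measure.dirac ((jumpTime k e).toNNReal, x) else 0)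
      (fun _ => 0) (jumpState k e)

/-- The internal history `ℱ_t = σ(μ^*([0, s] × D) : s ≤ t, D ∈ ℬ(S))`. -/
@[reducible] noncomputable def history (S : Type u) [MeasurableSpace S] (t : ℝ≥0) : MeasurableSpace (Path S) :=
  ⨆ s : ℝ≥0, ⨆ _ : s ≤ t, ⨆ D : Set S, ⨆ _ : MeasurableSet D,
    MeasurableSpace.comap (fun e : Path S => jumpMeasure e (Iic s ×ˢ D)) inferInstance

/-- `ℱ_{t-} = ⋁_{s < t} ℱ_s`. -/
@[reducible] noncomputable def historyBefore (S : Type u) [MeasurableSpace S] (t : ℝ≥0) : MeasurableSpace (Path S) :=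
  ⨆ s : ℝ≥0, ⨆ _ : s < t, history S s

/-- The predictable `σ`-algebra on `Ω × [0, ∞)`, generated by the sets `B × {0}` with `B ∈ ℱ_0`
and `C × (s, ∞)` with `C ∈ ℱ_{s-}`, `s > 0`. -/
@[reducible] noncomputable def predictable (S : Type u) [MeasurableSpace S] : MeasurableSpace (Path S × ℝ≥0) :=
  MeasurableSpace.generateFrom
    ({E | ∃ B, MeasurableSet[history S 0] B ∧ E = B ×ˢ {0}} ∪
      {E | ∃ s : ℝ≥0, 0 < s ∧ ∃ C, MeasurableSet[historyBefore S s] C ∧ E = C ×ˢ Ioi s})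

/-- A (randomized, history-dependent) policy: a transition probability `π(da | e, t)` from `Ω × [0, ∞)`
with the predictable `σ`-algebra to `A_∞` with `π(A(ξ_{t-}(e)) | e, t) = 1`. -/
structure Policy (𝓜 : Model S A N) where
  act : Path S → ℝ≥0 → Measure (A ⊕ Unit)
  predictable_act : ∀ B, MeasurableSet B →
    Measurable[predictable S] fun p : Path S × ℝ≥0 => act p.1 p.2 B
  isProbabilityMeasure_act : ∀ e t, IsProbabilityMeasure (act e t)
  act_adm : ∀ e t, act e t (𝓜.admInfty (stateBefore t e)) = 1

instance (𝓜 : Model S A N) (π : Policy 𝓜) (e : Path S) (t : ℝ≥0) :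
    IsProbabilityMeasure (π.act e t) := π.isProbabilityMeasure_act e t

theorem measurable_coord (k : ℕ) :
    Measurable fun e : Path S => (show (Ioi (0 : ℝ) × S) ⊕ Unit from e.1 (k + 1)) :=
  (measurable_pi_apply (k + 1)).comp measurable_subtype_coe

theorem measurable_sojourn (k : ℕ) : Measurable (sojourn k : Path S → ℝ≥0∞) := by
  have : Measurable (Sum.elim (fun p : Ioi (0 : ℝ) × S => ENNReal.ofReal p.1)
      (fun _ : Unit => ∞)) :=
    measurable_fun_sum (by fun_prop) measurable_const
  exact this.comp (measurable_coord k)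

theorem measurable_jumpTime (k : ℕ) : Measurable (jumpTime k : Path S → ℝ≥0∞) :=
  Finset.measurable_fun_sum _ fun i _ => measurable_sojourn i

theorem measurable_jumpState : ∀ k, Measurable (jumpState k : Path S → S ⊕ Unit)
  | 0 => measurable_inl.comp ((measurable_pi_apply 0).comp measurable_subtype_coe)
  | k + 1 => by
    have : Measurable (Sum.map Prod.snd id : (Ioi (0 : ℝ) × S) ⊕ Unit → S ⊕ Unit) :=
      measurable_fun_sum (measurable_inl.comp measurable_snd) measurable_inr
    exact this.comp (measurable_coord k)

theorem measurable_jumpMeasure (s : ℝ≥0) {D : Set S} (hD : MeasurableSet D) :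
    Measurable fun e : Path S => jumpMeasure e (Iic s ×ˢ D) := by
  classical
  have hB : MeasurableSet (Iic s ×ˢ D) := measurableSet_Iic.prod hD
  have h : ∀ (e : Path S), jumpMeasure e (Iic s ×ˢ D) =
      ∑' k, if jumpState k e ∈ Sum.inl '' D ∧ jumpTime k e ≤ s then 1 else 0 := fun e => by
    rw [jumpMeasure, Measure.sum_apply _ hB]
    refine tsum_congr fun k => ?_
    rcases hx : jumpState k e with x | x
    · by_cases ht : jumpTime k e < ∞
      · have : (jumpTime k e).toNNReal ≤ s ↔ jumpTime k e ≤ s := by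
          rw [← ENNReal.coe_le_coe, ENNReal.coe_toNNReal ht.ne]
        simp only [Sum.elim_inl, ht, if_true, Measure.dirac_apply' _ hB, indicator_apply, mem_prod,
          mem_Iic, this, Pi.one_apply, Sum.inl_injective.mem_set_image, and_comm]
      · have : ¬ jumpTime k e ≤ s := fun h => ht (h.trans_lt ENNReal.coe_lt_top)
        simp [ht, this]
    · simp
  simp_rw [h]
  refine Measurable.tsum fun k => Measurable.ite ?_ measurable_const measurable_const
  exact (measurable_jumpState k (measurableSet_inl_image.2 hD)).inter
    (measurable_jumpTime k measurableSet_Iic)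

theorem history_le (t : ℝ≥0) : history S t ≤ instMeasurableSpacePath :=
  iSup₂_le fun s _ => iSup₂_le fun _ hD => (measurable_jumpMeasure s hD).comap_le

theorem predictable_le : predictable S ≤ (inferInstance : MeasurableSpace (Path S × ℝ≥0)) := by
  refine MeasurableSpace.generateFrom_le ?_
  rintro E (⟨B, hB, rfl⟩ | ⟨s, -, C, hC, rfl⟩)
  · exact (history_le 0 B hB).prod (measurableSet_singleton 0)
  · have : historyBefore S s ≤ instMeasurableSpacePath := iSup₂_le fun t _ => history_le t
    exact (this C hC).prod measurableSet_Ioi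

end Paths

section Law

open Classical in
/-- Replaces all coordinates after the first occurrence of `(∞, x_∞)` by `(∞, x_∞)`. -/
noncomputable def kill (e : (n : ℕ) → Coord S n) : Path S :=
  ⟨fun n => match n with
    | 0 => e 0
    | n + 1 => if ∃ i ≤ n, e (i + 1) = Coord.dead then Coord.dead else e (n + 1),
  fun n hn => by
    by_cases h : ∃ i ≤ n, e (i + 1) = Coord.dead
    · obtain ⟨i, hi, hd⟩ := h
      exact if_pos ⟨i, hi.trans n.le_succ, hd⟩
    · have : e (n + 1) = Coord.dead := by simpa only [if_neg h] using hn
      exact absurd ⟨n, le_rfl, this⟩ h⟩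

theorem measurable_jump {n : ℕ} : Measurable (Coord.jump : Ioi (0 : ℝ) × S → Coord S (n + 1)) :=
  (measurable_inl : Measurable (Sum.inl : Ioi (0 : ℝ) × S → (Ioi (0 : ℝ) × S) ⊕ Unit))

theorem measurableSet_dead (n : ℕ) :
    MeasurableSet {e : (n : ℕ) → Coord S n | e (n + 1) = Coord.dead} := by
  have h : MeasurableSet ({Sum.inr ()} : Set ((Ioi (0 : ℝ) × S) ⊕ Unit)) := by
    rw [← image_singleton]
    exact measurableSet_inr_image.2 (measurableSet_singleton ())
  exact (measurable_pi_apply (n + 1) : Measurable fun e : (n : ℕ) → Coord S n => e (n + 1)) h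

theorem measurable_kill : Measurable (kill : ((n : ℕ) → Coord S n) → Path S) := by
  classical
  refine Measurable.subtype_mk (measurable_pi_iff.2 fun n => ?_)
  cases n with
  | zero => exact measurable_pi_apply 0
  | succ n =>
    refine Measurable.ite ?_ measurable_const (measurable_pi_apply (n + 1))
    have : {e : (n : ℕ) → Coord S n | ∃ i ≤ n, e (i + 1) = Coord.dead}
        = ⋃ i ∈ Iic n, {e | e (i + 1) = Coord.dead} := by
      ext e; simp
    rw [this]
    exact MeasurableSet.biUnion (finite_Iic n).countable fun i _ => measurableSet_dead i

/-- The path that follows the history `h_k = (x_0, θ_1, x_1, …, θ_k, x_k)` and does not jump any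
more: `(x_0, θ_1, x_1, …, θ_k, x_k, ∞, x_∞, ∞, x_∞, …)`. -/
noncomputable def stopped (k : ℕ) (h : (i : Finset.Iic k) → Coord S i) : Path S :=
  kill fun n => match n with
    | 0 => h ⟨0, by simp⟩
    | n + 1 => if hn : n + 1 ≤ k then h ⟨n + 1, by simpa using hn⟩ else Coord.dead

theorem measurable_stopped (k : ℕ) :
    Measurable (stopped k : ((i : Finset.Iic k) → Coord S i) → Path S) := by
  refine measurable_kill.comp (measurable_pi_iff.2 fun n => ?_)
  cases n with
  | zero => exact measurable_pi_apply _
  | succ n =>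
    by_cases hn : n + 1 ≤ k
    · simp only [hn, dite_true]; exact measurable_pi_apply _
    · simp only [hn, dite_false]; exact measurable_const

/-- The history `h_0 = x`. -/
def initialHistory (x : S) : (i : Finset.Iic 0) → Coord S i := fun i => match i with
  | ⟨0, _⟩ => x
  | ⟨_ + 1, _⟩ => Coord.dead

theorem measurable_initialHistory :
    Measurable (initialHistory : S → (i : Finset.Iic 0) → Coord S i) := by
  refine measurable_pi_iff.2 fun i => ?_
  match i with
  | ⟨0, _⟩ => exact measurable_id
  | ⟨_ + 1, _⟩ => exact measurable_const

variable [StandardBorelSpace S] {𝓜 : Model S A N}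

/-- The action distribution at time `T_k + s`, `s > 0`, given the history `h_k` and no jump before
that time. By predictability, `π(· | e, t)` for `T_k(e) < t ≤ T_{k+1}(e)` depends only on `h_k(e)` and
`t - T_k(e)`, so it is its value at the path stopped after `h_k`; the values at paths `e` with `T_{k+1}(e) ≥ T_k(e) + s`
all agree with it. -/
noncomputable def Policy.actAfter (π : Policy 𝓜) (k : ℕ) :
    Kernel (((i : Finset.Iic k) → Coord S i) × Ioi (0 : ℝ)) (A ⊕ Unit) where
  toFun p := π.act (stopped k p.1)
    ((jumpTime k (stopped k p.1)).toNNReal + (p.2 : ℝ).toNNReal)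
  measurable' := by
    refine Measure.measurable_of_measurable_coe _ fun B hB => ?_
    have h1 : Measurable fun p : Path S × ℝ≥0 => π.act p.1 p.2 B :=
      (π.predictable_act B hB).mono predictable_le le_rfl
    have h2 : Measurable fun p : ((i : Finset.Iic k) → Coord S i) × Ioi (0 : ℝ) =>
        stopped k p.1 := (measurable_stopped k).comp measurable_fst
    exact h1.comp (h2.prodMk ((((measurable_jumpTime k).comp h2).ennreal_toNNReal).add
      (measurable_subtype_coe.comp measurable_snd).real_toNNReal))

instance (π : Policy 𝓜) (k : ℕ) : IsMarkovKernel (π.actAfter k) :=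
  ⟨fun _ => π.isProbabilityMeasure_act _ _⟩

/-- The jump intensity `m_k(dx | h_k, s) = ∫ π(da | h_k, T_k + s) q(dx ∖ {x_k} | x_k, a)` at time `s > 0`
after the `k`-th jump, given the history `h_k`. It is `0` if `x_k = x_∞`. -/
noncomputable def Policy.intensity (π : Policy 𝓜) (k : ℕ) :
    Kernel (((i : Finset.Iic k) → Coord S i) × Ioi (0 : ℝ)) S :=
  𝓜.jumpRate ∘ₖ (Kernel.deterministic (fun p => jumpState k (stopped k p.1))
    ((measurable_jumpState k).comp ((measurable_stopped k).comp measurable_fst)) ×ₖ π.actAfter k)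

theorem Policy.intensity_apply (π : Policy 𝓜) (k : ℕ)
    (p : ((i : Finset.Iic k) → Coord S i) × Ioi (0 : ℝ)) {D : Set S} (hD : MeasurableSet D) :
    π.intensity k p D = ∫⁻ a, 𝓜.jumpRate (jumpState k (stopped k p.1), a) D
      ∂π.act (stopped k p.1) ((jumpTime k (stopped k p.1)).toNNReal + (p.2 : ℝ).toNNReal) := by
  rw [intensity, Kernel.comp_apply' _ _ _ hD, Kernel.prod_apply, Kernel.deterministic_apply,
    Measure.dirac_prod, lintegral_map (Kernel.measurable_coe _ hD) measurable_prodMk_left]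
  rfl

/-- `exp (-∫_0^s m_k(S | h_k, v) dv)`, the probability of no jump within time `s` after the
`k`-th jump. -/
noncomputable def Policy.survival (π : Policy 𝓜) (k : ℕ) (h : (i : Finset.Iic k) → Coord S i)
    (s : Ioi (0 : ℝ)) : ℝ≥0∞ :=
  expNeg (∫⁻ v in Iic s, π.intensity k (h, v) univ ∂posLebesgue)

/-- `exp (-∫_0^∞ m_k(S | h_k, v) dv)`, the probability of no further jump. -/
noncomputable def Policy.survivalInfty (π : Policy 𝓜) (k : ℕ)
    (h : (i : Finset.Iic k) → Coord S i) : ℝ≥0∞ :=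
  expNeg (∫⁻ v, π.intensity k (h, v) univ ∂posLebesgue)

/-- The conditional law of `(Θ_{k+1}, X_{k+1})` given the history `h_k`:
`m_k(dx | h_k, s) exp (-∫_0^s m_k(S | h_k, v) dv) ds` on `(0, ∞) × S`, and the mass
`exp (-∫_0^∞ m_k(S | h_k, v) dv)` at `(∞, x_∞)`. After `(∞, x_∞)` one has `m_k = 0`, and `(∞, x_∞)` is repeated. -/
noncomputable def Policy.step (π : Policy 𝓜) (k : ℕ) :
    Kernel ((i : Finset.Iic k) → Coord S i) (Coord S (k + 1)) :=
  (Kernel.withDensity (Kernel.const _ posLebesgue) (π.survival k) ⊗ₖ π.intensity k).map Coord.jump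
    + Kernel.withDensity (Kernel.const _ (Measure.dirac Coord.dead))
      (fun h _ => π.survivalInfty k h)

instance (π : Policy 𝓜) (k : ℕ) : IsSFiniteKernel (π.intensity k) := by
  unfold Policy.intensity; infer_instance

theorem Policy.measurable_survival (π : Policy 𝓜) (k : ℕ) :
    Measurable (Function.uncurry (π.survival k)) := by
  have h1 : Measurable fun p : (((i : Finset.Iic k) → Coord S i) × Ioi (0 : ℝ)) × Ioi (0 : ℝ) =>
      {q : (((i : Finset.Iic k) → Coord S i) × Ioi (0 : ℝ)) × Ioi (0 : ℝ) | q.2 ≤ q.1.2}.indicator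
        (fun q => π.intensity k (q.1.1, q.2) univ) p := by
    refine Measurable.indicator ?_ (measurableSet_le measurable_snd
      (measurable_snd.comp measurable_fst))
    exact ((π.intensity k).measurable_coe MeasurableSet.univ).comp
      ((measurable_fst.comp measurable_fst).prodMk measurable_snd)
  have h2 := measurable_expNeg.comp (h1.lintegral_prod_right' (ν := posLebesgue))
  convert h2 using 1
  funext p
  simp only [Function.uncurry, survival, Function.comp_apply]
  rw [← lintegral_indicator measurableSet_Iic]
  rfl

theorem Policy.measurable_survivalInfty (π : Policy 𝓜) (k : ℕ) :
    Measurable (π.survivalInfty k) :=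
  measurable_expNeg.comp
    (((π.intensity k).measurable_coe MeasurableSet.univ).lintegral_prod_right' (ν := posLebesgue))

instance (π : Policy 𝓜) (k : ℕ) :
    IsSFiniteKernel (Kernel.withDensity (Kernel.const _ posLebesgue) (π.survival k)) :=
  Kernel.IsSFiniteKernel.withDensity _ fun _ _ => expNeg_ne_top _

theorem Policy.step_apply (π : Policy 𝓜) (k : ℕ) (h : (i : Finset.Iic k) → Coord S i)
    {B : Set (Coord S (k + 1))} (hB : MeasurableSet B) :
    π.step k h B
      = (∫⁻ s, expNeg (∫⁻ v in Iic s, π.intensity k (h, v) univ ∂posLebesgue)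
          * π.intensity k (h, s) {x | Coord.jump (s, x) ∈ B} ∂posLebesgue)
        + expNeg (∫⁻ v, π.intensity k (h, v) univ ∂posLebesgue)
          * Measure.dirac Coord.dead B := by
  have hm : Measurable fun s => π.survival k h s :=
    (π.measurable_survival k).comp measurable_prodMk_left
  have hI : Measurable (Function.uncurry fun (h : (i : Finset.Iic k) → Coord S i)
      (_ : Coord S (k + 1)) => π.survivalInfty k h) :=
    (π.measurable_survivalInfty k).comp measurable_fst
  have hJ := measurable_jump (S := S) (n := k) hB
  rw [step, add_apply, Measure.add_apply, Kernel.map_apply' _ measurable_jump _ hB,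
    Kernel.compProd_apply hJ, Kernel.withDensity_apply _ (π.measurable_survival k),
    Kernel.withDensity_apply _ hI,
    withDensity_const, Kernel.const_apply, Kernel.const_apply, Measure.smul_apply, smul_eq_mul,
    lintegral_withDensity_eq_lintegral_mul _ hm]
  · rfl
  · exact (Kernel.measurable_kernel_prodMk_left' hJ h)

theorem Policy.exists_intensity_le (π : Policy 𝓜) (k : ℕ) (h : (i : Finset.Iic k) → Coord S i) :
    ∃ C : ℝ≥0, ∀ s, π.intensity k (h, s) univ ≤ C := by
  obtain ⟨C, hC⟩ := 𝓜.jumpRate_bound (jumpState k (stopped k h))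
  refine ⟨C, fun s => ?_⟩
  rw [π.intensity_apply k _ MeasurableSet.univ]
  refine (lintegral_mono fun a => hC a).trans ?_
  simp

instance (π : Policy 𝓜) (k : ℕ) : IsMarkovKernel (π.step k) := by
  refine ⟨fun h => ⟨?_⟩⟩
  obtain ⟨C, hC⟩ := π.exists_intensity_le k h
  rw [π.step_apply k h MeasurableSet.univ]
  simp only [mem_univ, ofPred_true, measure_univ, mul_one]
  exact lintegral_hazard _ C
    (((π.intensity k).measurable_coe MeasurableSet.univ).comp measurable_prodMk_left) hC

/-- The kernel `x ↦ P^π_x`: the law of the path `(x_0, θ_1, x_1, …)` with `x_0 = x` and with the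
successive conditional laws `Policy.step` (by the Ionescu-Tulcea theorem). -/
noncomputable def Policy.law (π : Policy 𝓜) : Kernel S (Path S) :=
  ((Kernel.traj π.step 0).comap initialHistory measurable_initialHistory).map kill

end Law

section Criteria

variable [StandardBorelSpace S] {𝓜 : Model S A N}

/-- The average `∫_A u(ξ_{t-}(e), a) π(da | e, t)`. -/
noncomputable def Policy.running (π : Policy 𝓜) (u : 𝓜.K → ℝ) (t : ℝ≥0) (e : Path S) : ℝ :=
  ∫ a, 𝓜.extendZero u (stateBefore t e, a) ∂π.act e t

/-- `V_α(x, π, u) = ∫_0^∞ e^{-αt} E^π_x[∫_A u(ξ_{t-}, a) π(da | e, t)] dt`. -/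
noncomputable def Policy.value (π : Policy 𝓜) (α : ℝ) (u : 𝓜.K → ℝ) (x : S) : ℝ :=
  ∫ t in Ioi (0 : ℝ), Real.exp (-α * t) * ∫ e, π.running u t.toNNReal e ∂π.law x

/-- All integrals in the definition of `V_α(x, π, u)` are well defined and finite. -/
structure Policy.ValueFinite (π : Policy 𝓜) (α : ℝ) (u : 𝓜.K → ℝ) (x : S) : Prop where
  action : ∀ t e, Integrable (fun a => 𝓜.extendZero u (stateBefore t e, a)) (π.act e t)
  path : ∀ t, Integrable (fun e => π.running u t e) (π.law x)
  time : IntegrableOn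
    (fun t : ℝ => Real.exp (-α * t) * ∫ e, π.running u t.toNNReal e ∂π.law x) (Ioi 0)

/-- `V_α(π, u) = ∫_S V_α(x, π, u) γ(dx)`. -/
noncomputable def Policy.totalValue (π : Policy 𝓜) (α : ℝ) (γ : Measure S) (u : 𝓜.K → ℝ) : ℝ :=
  ∫ x, π.value α u x ∂γ

/-- A function on `S` with values in `[0, ∞)`, as a function on `S_∞` that vanishes at `x_∞`. -/
noncomputable def extState (w : S → ℝ) : S ⊕ Unit → ℝ≥0∞ :=
  Sum.elim (fun x => ENNReal.ofReal (w x)) (fun _ => 0)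

/-- The growth (nonexplosion) condition on the transition rates, for a function `w`, constants
`ρ`, `b` and sets `S_k`; the infimum over the empty set is `∞`. -/
structure GrowthCondition [TopologicalSpace S] (𝓜 : Model S A N) (w : S → ℝ) (ρ b : ℝ) (Sk : ℕ → Set S) :
    Prop where
  continuous_w : Continuous w
  one_le_w : ∀ x, 1 ≤ w x
  rho_nonneg : 0 ≤ ρ
  b_nonneg : 0 ≤ b
  monotone_Sk : Monotone Sk
  integrable_w : ∀ z : 𝓜.K, (𝓜.q z).Integrable w
  drift : ∀ z : 𝓜.K, ∫ᵛ y, w y ∂•(𝓜.q z) ≤ ρ * w z.1.1 + b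
  tendsto_inf_w : Tendsto (fun k => ⨅ x ∈ (Sk k)ᶜ, ENNReal.ofReal (w x)) atTop (𝓝 ∞)
  iUnion_Sk : ⋃ k, Sk k = univ
  bounded_rates : ∀ k, ∃ C : ℝ, ∀ z : 𝓜.K, z.1.1 ∈ Sk k → |𝓜.q z {z.1.1}| ≤ C

/-- The condition on the costs `c_0 = -r, c_1, …, c_N`, the discount factor `α` and the initial
distribution `γ`, with `w` and `ρ` as in `GrowthCondition`. -/
structure CostCondition (𝓜 : Model S A N) (w : S → ℝ) (ρ M α : ℝ) (γ : Measure S) : Prop where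
  M_pos : 0 < M
  abs_cost_le : ∀ (n : Fin (N + 1)) (z : 𝓜.K), |𝓜.cost n z| ≤ M * w z.1.1
  rho_lt : ρ < α
  integrable_w : Integrable w γ

end Criteria

end Definitions

end CTMDP

namespace CTMDP

/-! ### Jump rates: splitting off the diagonal mass, and bounds on them -/

section Rates

variable {S A : Type*} [MeasurableSpace S] [MeasurableSpace A] {N : ℕ} [StandardBorelSpace S]

/-! The drift condition makes `w` a Lyapunov function. Let g(u, W) be the solution at time u of y' =
ρy + b, y(0) = W (`growthBound`). The core is the estimate E[w(ξ_t)] ≤ g(t, w(x)). No generator or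
Kolmogorov equation is available for a history-dependent policy, so the estimate is proved jump by
jump. On T_n ≤ t put Y_n = g(t - T_n, w(X_n)), and put Z_n = w(X_n) on T_n ≤ t < T_{n+1}; both
vanish elsewhere. Then E[Y_{n+1} + Z_n | h_n] ≤ Y_n (`lintegral_step_le`). This follows from
integration by parts against the survival function of the next sojourn, since g is affine in W and
solves the equation with which the drift condition compares. Telescoping bounds the sum of the
E[Z_n], which dominates E[w(ξ_t)] (`lintegral_stateAt_le`).

This alone does not exclude explosion, because `extState` vanishes at x_∞. Two estimates exclude it
(`ae_exists_lt_jumpTime`). Stopping the telescoping when `w` first exceeds a level j gives a maximal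
inequality: j times the probability of such an exit by time t is at most g(t, w(x)). On paths that
stay in {w ≤ j} the jump rates have a common bound C, so E[exp(-T_n)] loses a factor 1 + 1/C at
every jump, and infinitely many jumps before t have probability 0. An explosion before t must
therefore exit every level, and the maximal inequality gives it probability 0.

The jump epochs have no atoms, so ξ_{t-} = ξ_t almost surely for each fixed t. Hence the
admissibility of actions, imposed at ξ_{t-}, transfers to ξ_t. The value bounds come from |c_n| ≤ M
w, from the estimate of E[w(ξ_t)], and from the Laplace transform of g(·, W) at α > ρ, which is (αW
+ b)/(α(α - ρ)). Integrating over γ gives the bound on the total value. -/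

instance (𝓜 : Model S A N) (z : 𝓜.K) : IsFiniteMeasure (𝓜.jumpMeasureOn z) := by
  refine ⟨?_⟩
  rw [𝓜.jumpMeasureOn_apply z MeasurableSet.univ]
  exact ENNReal.ofReal_lt_top

theorem Model.q_eq_toSignedMeasure_add_dirac (𝓜 : Model S A N) (z : 𝓜.K) :
    𝓜.q z = (𝓜.jumpMeasureOn z).toSignedMeasure + VectorMeasure.dirac z.1.1 (𝓜.q z {z.1.1}) := by
  ext D hD
  have hJ : (𝓜.jumpMeasureOn z).real D = 𝓜.q z (D \ {z.1.1}) := by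
    rw [Measure.real, 𝓜.jumpMeasureOn_apply z hD, ENNReal.toReal_ofReal]
    exact 𝓜.q_nonneg z _ (hD.diff (measurableSet_singleton _)) (by simp)
  rw [add_apply, Measure.toSignedMeasure_apply_measurable hD, hJ]
  by_cases hx : z.1.1 ∈ D
  · rw [VectorMeasure.dirac_apply_of_mem hD hx, add_comm]
    exact (VectorMeasure.of_add_of_sdiff (v := 𝓜.q z) (measurableSet_singleton z.1.1) hD
      (by simpa using hx)).symm
  · rw [VectorMeasure.dirac_apply_of_notMem hx, add_zero, sdiff_singleton_eq_self hx]

theorem Model.jumpMeasureOn_univ (𝓜 : Model S A N) (z : 𝓜.K) :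
    𝓜.jumpMeasureOn z univ = ENNReal.ofReal (-𝓜.q z {z.1.1}) := by
  rw [𝓜.jumpMeasureOn_apply z MeasurableSet.univ]
  have h1 := VectorMeasure.of_add_of_sdiff (v := 𝓜.q z) (measurableSet_singleton z.1.1)
    MeasurableSet.univ (subset_univ _)
  rw [𝓜.q_univ] at h1
  congr 1
  linarith

/-- Integrability against the signed measure q means integrability against its variation; this
domination transfers it to the jump measure. -/
theorem Model.jumpMeasureOn_le_variation (𝓜 : Model S A N) (z : 𝓜.K) :
    𝓜.jumpMeasureOn z ≤ (𝓜.q z).variation := by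
  refine Measure.le_iff.2 fun D hD => ?_
  rw [𝓜.jumpMeasureOn_apply z hD]
  refine (Real.ofReal_le_enorm _).trans ((VectorMeasure.enorm_measure_le_variation _ _).trans
    (measure_mono sdiff_subset))

/-- The drift condition on `w`, expressed through the measure `q(· ∖ {x} | x, a)`. -/
theorem GrowthCondition.lintegral_jumpMeasureOn_le [TopologicalSpace S] {𝓜 : Model S A N}
    {w : S → ℝ} {ρ b : ℝ} {Sk : ℕ → Set S} (hA : GrowthCondition 𝓜 w ρ b Sk) (z : 𝓜.K) :
    ∫⁻ y, ENNReal.ofReal (w y) ∂𝓜.jumpMeasureOn z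
      ≤ ENNReal.ofReal (ρ * w z.1.1 + b)
        + 𝓜.jumpMeasureOn z univ * ENNReal.ofReal (w z.1.1) := by
  have hw0 : ∀ y, 0 ≤ w y := fun y => zero_le_one.trans (hA.one_le_w y)
  have hq0 : 0 ≤ -𝓜.q z {z.1.1} := by
    have h1 := VectorMeasure.of_add_of_sdiff (v := 𝓜.q z) (measurableSet_singleton z.1.1)
      MeasurableSet.univ (subset_univ _)
    have h2 := 𝓜.q_nonneg z (univ \ {z.1.1})
      (MeasurableSet.univ.diff (measurableSet_singleton _)) (by simp)
    rw [𝓜.q_univ] at h1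
    linarith
  have hJ : Integrable w (𝓜.jumpMeasureOn z) :=
    (hA.integrable_w z).mono_measure (𝓜.jumpMeasureOn_le_variation z)
  have hJ' : (𝓜.jumpMeasureOn z).toSignedMeasure.Integrable w := by
    rw [VectorMeasure.Integrable, Measure.variation_toSignedMeasure]; exact hJ
  have hd : (VectorMeasure.dirac z.1.1 (𝓜.q z {z.1.1})).Integrable w := by
    rw [VectorMeasure.Integrable, VectorMeasure.variation_dirac]
    exact (integrable_dirac (by simp)).smul_measure (by simp)
  have hdr := hA.drift z
  -- The real pairing is symmetric; the flipped form is the one to which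
  -- `VectorMeasure.integral_toSignedMeasure` applies.
  have hflip : (ContinuousLinearMap.lsmul ℝ ℝ : ℝ →L[ℝ] ℝ →L[ℝ] ℝ)
      = (ContinuousLinearMap.lsmul ℝ ℝ).flip := by
    ext; simp
  rw [𝓜.q_eq_toSignedMeasure_add_dirac z, VectorMeasure.integral_add_vectorMeasure hJ' hd,
    VectorMeasure.integral_dirac, hflip, VectorMeasure.integral_toSignedMeasure] at hdr
  simp only [ContinuousLinearMap.flip_apply, ContinuousLinearMap.lsmul_apply, smul_eq_mul] at hdr
  -- The diagonal term of ∫ w dq is q({x}) w(x), and q({x}) is minus the total jump rate. Moving it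
  -- to the right makes every term nonnegative.
  rw [← ofReal_integral_eq_lintegral_ofReal hJ (ae_of_all _ hw0), 𝓜.jumpMeasureOn_univ,
    ← ENNReal.ofReal_mul hq0, ← ENNReal.ofReal_add _ (mul_nonneg hq0 (hw0 _))]
  · exact ENNReal.ofReal_le_ofReal (by linarith)
  · exact add_nonneg (mul_nonneg hA.rho_nonneg (hw0 _)) hA.b_nonneg

/-- Since the infimum of `w` off S_k tends to infinity, {w ≤ j} lies inside some S_k, where the
rates are uniformly bounded. -/
theorem GrowthCondition.exists_jumpRate_le [TopologicalSpace S] {𝓜 : Model S A N}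
    {w : S → ℝ} {ρ b : ℝ} {Sk : ℕ → Set S} (hA : GrowthCondition 𝓜 w ρ b Sk) (j : ℝ) :
    ∃ C : ℝ≥0, ∀ x, w x ≤ j → ∀ a, 𝓜.jumpRate (Sum.inl x, a) univ ≤ C := by
  obtain ⟨k, hk⟩ := (hA.tendsto_inf_w.eventually_const_lt
    (ENNReal.ofReal_lt_top (r := j))).exists
  obtain ⟨C, hC⟩ := hA.bounded_rates k
  refine ⟨C.toNNReal, fun x hx a => ?_⟩
  by_cases h : (Sum.inl x, a) ∈ range 𝓜.incl
  · obtain ⟨z, hz⟩ := h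
    have hzx : z.1.1 = x := Sum.inl_injective (congrArg Prod.fst hz)
    have hxk : z.1.1 ∈ Sk k := by
      by_contra hn
      exact (hk.trans_le (iInf₂_le z.1.1 hn)).not_ge
        (ENNReal.ofReal_le_ofReal (hzx ▸ hx))
    rw [← hz, 𝓜.jumpRate_incl, 𝓜.jumpMeasureOn_univ]
    exact ENNReal.ofReal_le_ofReal ((neg_le_abs _).trans (hC z hxk))
  · simp [𝓜.jumpRate_of_notMem h]

theorem GrowthCondition.lintegral_jumpRate_le [TopologicalSpace S] {𝓜 : Model S A N}
    {w : S → ℝ} {ρ b : ℝ} {Sk : ℕ → Set S} (hA : GrowthCondition 𝓜 w ρ b Sk) (x : S)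
    (a : A ⊕ Unit) :
    ∫⁻ y, ENNReal.ofReal (w y) ∂𝓜.jumpRate (Sum.inl x, a)
      ≤ ENNReal.ofReal (ρ * w x + b)
        + 𝓜.jumpRate (Sum.inl x, a) univ * ENNReal.ofReal (w x) := by
  by_cases h : (Sum.inl x, a) ∈ range 𝓜.incl
  · obtain ⟨z, hz⟩ := h
    have hzx : z.1.1 = x := Sum.inl_injective (congrArg Prod.fst hz)
    rw [← hz, 𝓜.jumpRate_incl, ← hzx]
    exact hA.lintegral_jumpMeasureOn_le z
  · simp [𝓜.jumpRate_of_notMem h]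

end Rates

/-! ### Integration against the survival function of one sojourn -/

section Hazard

theorem setLIntegral_posLebesgue (g : ℝ → ℝ≥0∞) {u : ℝ} :
    ∫⁻ s in {s : Ioi (0 : ℝ) | (s : ℝ) ≤ u}, g s ∂posLebesgue = ∫⁻ s in Ioc 0 u, g s := by
  have him : ((↑) : Ioi (0 : ℝ) → ℝ) '' {s : Ioi (0 : ℝ) | (s : ℝ) ≤ u} = Ioc 0 u := by
    ext s; constructor
    · rintro ⟨v, hv, rfl⟩; exact ⟨v.2, hv⟩
    · intro hs; exact ⟨⟨s, hs.1⟩, hs.2, rfl⟩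
  rw [posLebesgue, setLIntegral_subtype measurableSet_Ioi _ g, him]

/-- Integration by parts against the survival function of a bounded hazard rate. -/
theorem lintegral_hazard_mul (f : Ioi (0 : ℝ) → ℝ≥0∞) (C : ℝ≥0) (hf : Measurable f)
    (hC : ∀ t, f t ≤ C) {φ ψ : ℝ → ℝ} {u : ℝ} (hu : 0 ≤ u)
    (hφ : ∀ s, HasDerivAt φ (-ψ s) s) (hψ : Continuous ψ)
    (hφ0 : ∀ s ∈ Icc 0 u, 0 ≤ φ s) (hψ0 : ∀ s ∈ Icc 0 u, 0 ≤ ψ s) :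
    (∫⁻ t in {t : Ioi (0 : ℝ) | (t : ℝ) ≤ u}, expNeg (∫⁻ s in Iic t, f s ∂posLebesgue)
        * (f t * ENNReal.ofReal (φ t) + ENNReal.ofReal (ψ t)) ∂posLebesgue)
      + expNeg (∫⁻ s in {s : Ioi (0 : ℝ) | (s : ℝ) ≤ u}, f s ∂posLebesgue) * ENNReal.ofReal (φ u)
      = ENNReal.ofReal (φ 0) := by
  have hfin : ∀ t, f t ≠ ∞ := fun t => ((hC t).trans_lt ENNReal.coe_lt_top).ne
  set g : ℝ → ℝ := Function.extend (↑) (fun t : Ioi (0 : ℝ) => (f t).toReal) 0 with hgdef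
  have hg : Measurable g :=
    (MeasurableEmbedding.subtype_coe measurableSet_Ioi).measurable_extend hf.ennreal_toReal
      measurable_const
  have hgval : ∀ t : Ioi (0 : ℝ), g t = (f t).toReal := fun t =>
    Subtype.val_injective.extend_apply _ _ t
  have hgcase : ∀ t, 0 ≤ g t ∧ g t ≤ C := fun t => by
    by_cases ht : 0 < t
    · have := hgval ⟨t, ht⟩
      rw [show g t = _ from this]
      exact ⟨ENNReal.toReal_nonneg, ENNReal.toReal_le_coe_of_le_coe (hC _)⟩
    · have : g t = 0 := Function.extend_apply' _ _ _ (by rintro ⟨s, rfl⟩; exact ht s.2)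
      rw [this]; exact ⟨le_rfl, C.2⟩
  have hfg : ∀ t : Ioi (0 : ℝ), f t = ENNReal.ofReal (g t) := fun t => by
    rw [hgval, ENNReal.ofReal_toReal (hfin t)]
  have hint : LocallyIntegrable g volume := by
    refine (locallyIntegrable_const (C : ℝ)).mono hg.aestronglyMeasurable
      (ae_of_all _ fun t => ?_)
    rw [Real.norm_of_nonneg (hgcase t).1, Real.norm_of_nonneg (NNReal.coe_nonneg C)]
    exact (hgcase t).2
  have hii : ∀ a b, IntervalIntegrable g volume a b := fun a b =>
    (hint.integrableOn_isCompact isCompact_uIcc).intervalIntegrable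
  set F : ℝ → ℝ := fun t => ∫ s in (0 : ℝ)..t, g s with hF
  have hFc : Continuous F := intervalIntegral.continuous_primitive hii 0
  have hFI : ∀ t, 0 ≤ t → ∫⁻ s in Ioc 0 t, ENNReal.ofReal (g s) = ENNReal.ofReal (F t) :=
    fun t ht => by
      rw [hF]; simp only
      rw [intervalIntegral.integral_of_le ht,
        ofReal_integral_eq_lintegral_ofReal (hii 0 t).1 (ae_of_all _ fun s => (hgcase s).1)]
  have hFnn : ∀ t, 0 ≤ t → 0 ≤ F t := fun t ht =>
    intervalIntegral.integral_nonneg ht fun s _ => (hgcase s).1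
  have hL' : ∀ t : ℝ, 0 ≤ t → ∫⁻ s in {s : Ioi (0 : ℝ) | (s : ℝ) ≤ t}, f s ∂posLebesgue
      = ENNReal.ofReal (F t) := fun t ht => by
    simp_rw [hfg]
    rw [setLIntegral_posLebesgue fun s => ENNReal.ofReal (g s), hFI t ht]
  have hL : ∀ t : Ioi (0 : ℝ), ∫⁻ s in Iic t, f s ∂posLebesgue = ENNReal.ofReal (F t) :=
    fun t => hL' t (le_of_lt t.2)
  have hexp : ∀ t, 0 ≤ t → expNeg (ENNReal.ofReal (F t)) = ENNReal.ofReal (Real.exp (-F t)) :=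
    fun t ht => by rw [expNeg_eq ENNReal.ofReal_ne_top, ENNReal.toReal_ofReal (hFnn t ht)]
  have hφc : Continuous φ := continuous_iff_continuousAt.2 fun s => (hφ s).continuousAt
  have hpl : LocallyIntegrable (fun t => g t * Real.exp (-F t)) volume := by
    refine locallyIntegrable_iff.2 fun K hK => ?_
    exact (hint.integrableOn_isCompact hK).mul_continuousOn
      (Real.continuous_exp.comp hFc.neg).continuousOn hK
  -- On [0, u] this is the survival function exp(-F). Written as an indefinite integral, its
  -- absolute continuity and its derivative almost everywhere are immediate, which is what
  -- integration by parts needs when the rate is only measurable.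
  set E : ℝ → ℝ := fun t => 1 - ∫ s in (0 : ℝ)..t, g s * Real.exp (-F s) with hE
  have hEeq : ∀ t, 0 ≤ t → E t = Real.exp (-F t) := fun t ht => by
    rw [hE]; simp only
    rw [lintegral_hazard_Icc g C hg (fun t => (hgcase t).1) (fun t => (hgcase t).2) t ht]
    ring
  have hEac : AbsolutelyContinuousOnInterval E 0 u :=
    (ContDiffOn.absolutelyContinuousOnInterval (contDiffOn_const (c := (1 : ℝ)))).sub
      ((hpl.integrableOn_isCompact isCompact_uIcc).intervalIntegrable
        |>.absolutelyContinuousOnInterval_intervalIntegral (by simp))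
  have hφac : AbsolutelyContinuousOnInterval φ 0 u := by
    refine ContDiffOn.absolutelyContinuousOnInterval (ContDiff.contDiffOn ?_)
    rw [contDiff_one_iff_deriv]
    refine ⟨fun s => (hφ s).differentiableAt, ?_⟩
    have : deriv φ = fun s => -ψ s := funext fun s => (hφ s).deriv
    rw [this]; exact hψ.neg
  have key : ∫ t in (0 : ℝ)..u, Real.exp (-F t) * (g t * φ t + ψ t)
      = φ 0 - Real.exp (-F u) * φ u := by
    have h := hEac.integral_deriv_mul_eq_sub hφac
    rw [hEeq 0 le_rfl, hEeq u hu, show F 0 = 0 by simp [hF], neg_zero, Real.exp_zero,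
      one_mul] at h
    rw [← neg_sub, ← h, ← intervalIntegral.integral_neg]
    refine intervalIntegral.integral_congr_ae ?_
    filter_upwards [LocallyIntegrable.ae_hasDerivAt_integral hpl] with t ht htu
    rw [uIoc_of_le hu] at htu
    rw [((ht 0).const_sub 1).deriv, (hφ t).deriv, hEeq t htu.1.le]
    ring
  have hi : IntegrableOn (fun t => Real.exp (-F t) * (g t * φ t + ψ t)) (Ioc 0 u) volume := by
    have h1 : IntegrableOn (fun t => g t * φ t + ψ t) (Icc 0 u) volume :=
      ((hint.integrableOn_isCompact isCompact_Icc).mul_continuousOn hφc.continuousOn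
        isCompact_Icc).add hψ.continuousOn.integrableOn_Icc
    exact (h1.continuousOn_mul (Real.continuous_exp.comp hFc.neg).continuousOn
      isCompact_Icc).mono_set Ioc_subset_Icc_self
  have e1 : ∫⁻ t in {t : Ioi (0 : ℝ) | (t : ℝ) ≤ u}, expNeg (∫⁻ s in Iic t, f s ∂posLebesgue)
        * (f t * ENNReal.ofReal (φ t) + ENNReal.ofReal (ψ t)) ∂posLebesgue
      = ENNReal.ofReal (∫ t in (0 : ℝ)..u, Real.exp (-F t) * (g t * φ t + ψ t)) := by
    rw [intervalIntegral.integral_of_le hu, ofReal_integral_eq_lintegral_ofReal hi,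
      ← setLIntegral_posLebesgue fun t => ENNReal.ofReal (Real.exp (-F t) * (g t * φ t + ψ t))]
    · refine setLIntegral_congr_fun (measurable_subtype_coe measurableSet_Iic) fun t ht => ?_
      have ht' : (t : ℝ) ∈ Icc 0 u := ⟨le_of_lt t.2, ht⟩
      rw [hL, hexp _ ht'.1, hfg, ← ENNReal.ofReal_mul (hgcase t).1,
        ← ENNReal.ofReal_add (mul_nonneg (hgcase t).1 (hφ0 _ ht')) (hψ0 _ ht'),
        ← ENNReal.ofReal_mul (Real.exp_pos _).le]
    · refine (ae_restrict_iff' measurableSet_Ioc).2 (ae_of_all _ fun t ht => ?_)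
      have ht' : t ∈ Icc 0 u := ⟨ht.1.le, ht.2⟩
      exact mul_nonneg (Real.exp_pos _).le
        (add_nonneg (mul_nonneg (hgcase t).1 (hφ0 _ ht')) (hψ0 _ ht'))
  have hEu : 0 ≤ ∫ t in (0 : ℝ)..u, Real.exp (-F t) * (g t * φ t + ψ t) :=
    intervalIntegral.integral_nonneg hu fun t ht => mul_nonneg (Real.exp_pos _).le
        (add_nonneg (mul_nonneg (hgcase t).1 (hφ0 _ ht)) (hψ0 _ ht))
  rw [e1, hL' u hu, hexp u hu, ← ENNReal.ofReal_mul (Real.exp_pos _).le,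
    ← ENNReal.ofReal_add hEu (mul_nonneg (Real.exp_pos _).le (hφ0 u ⟨hu, le_rfl⟩)), key]
  congr 1; ring

/-- With φ = 1 and ψ = 0, integration by parts says that the mass on (0, u] plus the survival at u
is 1. The total mass is also 1, and the finite mass on (0, u] cancels. -/
theorem lintegral_hazard_tail (f : Ioi (0 : ℝ) → ℝ≥0∞) (C : ℝ≥0) (hf : Measurable f)
    (hC : ∀ t, f t ≤ C) {u : ℝ} (hu : 0 ≤ u) :
    (∫⁻ t in {t : Ioi (0 : ℝ) | (t : ℝ) ≤ u}ᶜ, expNeg (∫⁻ s in Iic t, f s ∂posLebesgue) * f t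
        ∂posLebesgue) + expNeg (∫⁻ s, f s ∂posLebesgue)
      = expNeg (∫⁻ s in {s : Ioi (0 : ℝ) | (s : ℝ) ≤ u}, f s ∂posLebesgue) := by
  have h1 := lintegral_hazard_mul f C hf hC hu (φ := fun _ => 1) (ψ := fun _ => 0)
    (fun s => by simpa using hasDerivAt_const s (1 : ℝ)) continuous_const
    (fun _ _ => zero_le_one) (fun _ _ => le_rfl)
  have h2 := lintegral_hazard f C hf hC
  have hu' : MeasurableSet {t : Ioi (0 : ℝ) | (t : ℝ) ≤ u} :=
    measurable_subtype_coe measurableSet_Iic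
  simp only [ENNReal.ofReal_one, mul_one, ENNReal.ofReal_zero, add_zero] at h1
  rw [← lintegral_add_compl _ hu', add_assoc] at h2
  refine (ENNReal.add_right_inj ?_).1 (h2.trans h1.symm)
  exact (ne_top_of_le_ne_top ENNReal.one_ne_top (le_self_add.trans h1.le))

/-- The solution at time `u` of `y' = ρ y + b`, `y(0) = W`. -/
noncomputable def growthBound (ρ b u W : ℝ) : ℝ :=
  Real.exp (ρ * u) * W + b * ∫ s in (0 : ℝ)..u, Real.exp (ρ * s)

theorem hasDerivAt_integral_exp (ρ u : ℝ) :
    HasDerivAt (fun u => ∫ s in (0 : ℝ)..u, Real.exp (ρ * s)) (Real.exp (ρ * u)) u := by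
  have hc : Continuous fun s => Real.exp (ρ * s) := by fun_prop
  exact intervalIntegral.integral_hasDerivAt_right (hc.intervalIntegrable _ _)
    (hc.stronglyMeasurableAtFilter _ _) hc.continuousAt

theorem continuous_integral_exp (ρ : ℝ) :
    Continuous fun u => ∫ s in (0 : ℝ)..u, Real.exp (ρ * s) :=
  continuous_iff_continuousAt.2 fun u => (hasDerivAt_integral_exp ρ u).continuousAt

theorem integral_exp_nonneg {ρ u : ℝ} (hu : 0 ≤ u) : 0 ≤ ∫ s in (0 : ℝ)..u, Real.exp (ρ * s) :=
  intervalIntegral.integral_nonneg hu fun _ _ => (Real.exp_pos _).le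

theorem continuous_growthBound (ρ b : ℝ) :
    Continuous fun p : ℝ × ℝ => growthBound ρ b p.1 p.2 := by
  have h := continuous_integral_exp ρ
  unfold growthBound
  fun_prop

theorem growthBound_zero (ρ b W : ℝ) : growthBound ρ b 0 W = W := by simp [growthBound]

theorem growthBound_nonneg {ρ b u W : ℝ} (hb : 0 ≤ b) (hu : 0 ≤ u) (hW : 0 ≤ W) :
    0 ≤ growthBound ρ b u W :=
  add_nonneg (mul_nonneg (Real.exp_pos _).le hW) (mul_nonneg hb (integral_exp_nonneg hu))

theorem le_growthBound {ρ b u W : ℝ} (hρ : 0 ≤ ρ) (hb : 0 ≤ b) (hu : 0 ≤ u) (hW : 0 ≤ W) :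
    W ≤ growthBound ρ b u W := by
  have h1 : 1 ≤ Real.exp (ρ * u) := Real.one_le_exp (mul_nonneg hρ hu)
  have h2 : 0 ≤ b * ∫ s in (0 : ℝ)..u, Real.exp (ρ * s) := mul_nonneg hb (integral_exp_nonneg hu)
  unfold growthBound
  nlinarith

/-- The derivative is -ψ with ψ nonnegative (for ρW + b ≥ 0), the form required by
`lintegral_hazard_mul`: while waiting, the bound for the remaining time decreases at the rate which
the drift allows. -/
theorem growthBound_sub_hasDerivAt (ρ b u W s : ℝ) :
    HasDerivAt (fun s => growthBound ρ b (u - s) W)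
      (-(Real.exp (ρ * (u - s)) * (ρ * W + b))) s := by
  have h0 : HasDerivAt (fun s : ℝ => u - s) (-1) s := (hasDerivAt_id s).const_sub u
  have h1 : HasDerivAt (fun s => Real.exp (ρ * (u - s)))
      (Real.exp (ρ * (u - s)) * (ρ * (-1))) s := (h0.const_mul ρ).exp
  have h2 := (hasDerivAt_integral_exp ρ (u - s)).scomp s h0
  have h3 := (h1.mul_const W).add (h2.const_mul b)
  convert! h3 using 1
  simp only [smul_eq_mul]
  ring

/-- One jump with rate `m s univ` and post-jump distribution proportional to `m s`, where `w`
satisfies the drift condition, does not increase the expectation of `growthBound`. -/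
theorem lintegral_growthBound_le {S : Type*} [MeasurableSpace S] (m : Ioi (0 : ℝ) → Measure S)
    (C : ℝ≥0) (hm : Measurable fun s => m s univ) (hC : ∀ s, m s univ ≤ C) {w : S → ℝ}
    (hw : Measurable w) (hw0 : ∀ y, 0 ≤ w y) {ρ b W u : ℝ} (hρ : 0 ≤ ρ) (hb : 0 ≤ b)
    (hW : 0 ≤ W) (hu : 0 ≤ u)
    (hdrift : ∀ s, ∫⁻ y, ENNReal.ofReal (w y) ∂m s
      ≤ ENNReal.ofReal (ρ * W + b) + m s univ * ENNReal.ofReal W) :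
    (∫⁻ t in {t : Ioi (0 : ℝ) | (t : ℝ) ≤ u}, expNeg (∫⁻ s in Iic t, m s univ ∂posLebesgue)
        * ∫⁻ y, ENNReal.ofReal (growthBound ρ b (u - t) (w y)) ∂m t ∂posLebesgue)
      + expNeg (∫⁻ s in {s : Ioi (0 : ℝ) | (s : ℝ) ≤ u}, m s univ ∂posLebesgue)
        * ENNReal.ofReal W
      ≤ ENNReal.ofReal (growthBound ρ b u W) := by
  have hρW : 0 ≤ ρ * W + b := add_nonneg (mul_nonneg hρ hW) hb
  -- The right-hand side becomes the integral of rate · g(u - t, W) + exp(ρ(u - t))(ρW + b) against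
  -- survival, so the integrands on both sides can be compared at each t.
  have key := lintegral_hazard_mul (fun s => m s univ) C hm hC hu
    (fun s => growthBound_sub_hasDerivAt ρ b u W s) (by fun_prop)
    (fun s hs => growthBound_nonneg hb (sub_nonneg.2 hs.2) hW)
    (fun s hs => mul_nonneg (Real.exp_pos _).le hρW)
  rw [sub_self, sub_zero, growthBound_zero] at key
  rw [← key]
  gcongr ?_ + _
  refine setLIntegral_mono' (measurable_subtype_coe measurableSet_Iic) fun t ht => ?_
  have htu : 0 ≤ u - (t : ℝ) := sub_nonneg.2 ht
  refine mul_le_mul_right ?_ _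
  set β : ℝ := b * ∫ s in (0 : ℝ)..(u - t), Real.exp (ρ * s) with hβ
  have hβ0 : 0 ≤ β := mul_nonneg hb (integral_exp_nonneg htu)
  set ε : ℝ := Real.exp (ρ * (u - t)) with hε
  have hε0 : 0 ≤ ε := (Real.exp_pos _).le
  -- The bound is affine in the starting value, so its integral over the post-jump state involves
  -- only ∫ w dm and the total rate, and the drift inequality applies directly.
  have hG : ∀ V, 0 ≤ V → ENNReal.ofReal (growthBound ρ b (u - t) V)
      = ENNReal.ofReal ε * ENNReal.ofReal V + ENNReal.ofReal β := fun V hV => by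
    rw [growthBound, ENNReal.ofReal_add (mul_nonneg hε0 hV) hβ0, ENNReal.ofReal_mul hε0]
  calc ∫⁻ y, ENNReal.ofReal (growthBound ρ b (u - t) (w y)) ∂m t
      = ENNReal.ofReal ε * ∫⁻ y, ENNReal.ofReal (w y) ∂m t + ENNReal.ofReal β * m t univ := by
        simp_rw [hG _ (hw0 _)]
        rw [lintegral_add_right _ measurable_const, lintegral_const,
          lintegral_const_mul _ hw.ennreal_ofReal]
    _ ≤ ENNReal.ofReal ε * (ENNReal.ofReal (ρ * W + b) + m t univ * ENNReal.ofReal W)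
        + ENNReal.ofReal β * m t univ := by gcongr; exact hdrift t
    _ = _ := by
        rw [hG W hW, ENNReal.ofReal_mul hε0]
        ring

/-- If the rate of the next jump is at most `C`, then its Laplace transform at `1` is at most
`C / (1 + C)`. -/
theorem lintegral_exp_neg_le (f : Ioi (0 : ℝ) → ℝ≥0∞) {C : ℝ≥0} (hC0 : C ≠ 0)
    (hf : Measurable f) (hC : ∀ t, f t ≤ C) {u : ℝ} (hu : 0 ≤ u) :
    (1 + (C : ℝ≥0∞)⁻¹) * ∫⁻ t in {t : Ioi (0 : ℝ) | (t : ℝ) ≤ u},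
      expNeg (∫⁻ s in Iic t, f s ∂posLebesgue) * (f t * ENNReal.ofReal (Real.exp (-t)))
        ∂posLebesgue ≤ 1 := by
  have hd : ∀ s : ℝ, HasDerivAt (fun s => Real.exp (-s)) (-Real.exp (-s)) s := fun s => by
    simpa using (hasDerivAt_neg s).exp
  -- Here φ = ψ = exp(-s). The ψ-term dominates f exp(-s)/C because f ≤ C; this produces the factor
  -- 1 + 1/C.
  have key := lintegral_hazard_mul f C hf hC hu hd (by fun_prop)
    (fun s _ => (Real.exp_pos _).le) (fun s _ => (Real.exp_pos _).le)
  rw [neg_zero, Real.exp_zero, ENNReal.ofReal_one] at key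
  rw [← lintegral_const_mul' _ _ (by simp [hC0])]
  refine le_trans ?_ (le_self_add.trans key.le)
  refine lintegral_mono fun t => ?_
  have h1 : (C : ℝ≥0∞)⁻¹ * f t ≤ 1 := by
    rw [mul_comm, ← div_eq_mul_inv]
    exact ENNReal.div_le_of_le_mul (by simpa using hC t)
  calc (1 + (C : ℝ≥0∞)⁻¹) * (expNeg (∫⁻ s in Iic t, f s ∂posLebesgue)
        * (f t * ENNReal.ofReal (Real.exp (-t))))
      = expNeg (∫⁻ s in Iic t, f s ∂posLebesgue) * (f t * ENNReal.ofReal (Real.exp (-t))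
        + (C : ℝ≥0∞)⁻¹ * f t * ENNReal.ofReal (Real.exp (-t))) := by ring
    _ ≤ expNeg (∫⁻ s in Iic t, f s ∂posLebesgue) * (f t * ENNReal.ofReal (Real.exp (-t))
        + 1 * ENNReal.ofReal (Real.exp (-t))) := by gcongr
    _ = _ := by rw [one_mul]

end Hazard

/-! ### Dependence of jump times and states on finitely many coordinates -/

section PathLemmas

variable {S : Type*}

theorem jumpTime_congr {p p' : Path S} {n : ℕ} (h : ∀ i ≤ n, p.1 i = p'.1 i) :
    jumpTime n p = jumpTime n p' := by
  refine Finset.sum_congr rfl fun i hi => ?_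
  rw [sojourn, sojourn, h (i + 1) (Finset.mem_range.1 hi)]

theorem jumpState_congr {p p' : Path S} {n : ℕ} (h : ∀ i ≤ n, p.1 i = p'.1 i) :
    jumpState n p = jumpState n p' := by
  cases n with
  | zero => simp only [jumpState, h 0 le_rfl]
  | succ n => simp only [jumpState, h (n + 1) le_rfl]

theorem kill_succ_of_dead {e : (n : ℕ) → Coord S n} {n i : ℕ} (hi : i ≤ n)
    (h : e (i + 1) = Coord.dead) : (kill e).1 (n + 1) = Coord.dead := if_pos ⟨i, hi, h⟩

theorem kill_succ_of_ne_dead {e : (n : ℕ) → Coord S n} {n : ℕ}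
    (h : ∀ i ≤ n, e (i + 1) ≠ Coord.dead) : (kill e).1 (n + 1) = e (n + 1) :=
  if_neg fun ⟨i, hi, hd⟩ => h i hi hd

theorem kill_congr {e e' : (n : ℕ) → Coord S n} {n : ℕ} (h : ∀ i ≤ n, e i = e' i) :
    ∀ i ≤ n, (kill e).1 i = (kill e').1 i := by
  intro i hi
  cases i with
  | zero => exact h 0 hi
  | succ i =>
    by_cases hd : ∃ j ≤ i, e (j + 1) = Coord.dead
    · obtain ⟨j, hj, hd⟩ := hd
      rw [kill_succ_of_dead hj hd, kill_succ_of_dead hj (by rw [← h (j + 1) (by omega), hd])]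
    · push Not at hd
      rw [kill_succ_of_ne_dead hd, kill_succ_of_ne_dead fun j hj => by
        rw [← h (j + 1) (by omega)]; exact hd j hj, h (i + 1) hi]

/-- The kernels of the law evaluate the policy along the stopped path of a history; this identifies
its epochs and states up to index n with those of the actual path. -/
theorem stopped_frestrictLe (e : (n : ℕ) → Coord S n) (n : ℕ) :
    ∀ i ≤ n, (stopped n (Preorder.frestrictLe n e)).1 i = (kill e).1 i := by
  unfold stopped
  refine kill_congr fun i hi => ?_
  cases i with
  | zero => rfl
  | succ i => simp only [hi, dite_true]; rfl

theorem jumpTime_succ (n : ℕ) (p : Path S) :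
    jumpTime (n + 1) p = jumpTime n p + sojourn n p := Finset.sum_range_succ _ _

theorem sojourn_pos (n : ℕ) (p : Path S) : 0 < sojourn n p := by
  unfold sojourn
  rcases p.1 (n + 1) with q | q
  · exact ENNReal.ofReal_pos.2 q.1.2
  · simp

theorem jumpTime_mono (p : Path S) : Monotone fun n => jumpTime n p :=
  monotone_nat_of_le_succ fun n => by rw [jumpTime_succ]; exact le_self_add

theorem sojourn_of_dead {n : ℕ} {p : Path S} (h : p.1 (n + 1) = Coord.dead) :
    sojourn n p = ∞ := by
  rw [sojourn, h]; rfl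

theorem exists_jumpState_eq_inl {n : ℕ} {p : Path S} (h : jumpTime n p ≠ ∞) :
    ∃ x, jumpState n p = Sum.inl x := by
  cases n with
  | zero => exact ⟨_, rfl⟩
  | succ n =>
    rw [jumpTime_succ] at h
    unfold sojourn at h
    rcases hp : (show (Ioi (0 : ℝ) × S) ⊕ Unit from p.1 (n + 1)) with q | q
    · exact ⟨q.2, congrArg (Sum.map Prod.snd id) hp⟩
    · exact absurd (by simp [show p.1 (n + 1) = _ from hp]) h

theorem ne_dead_of_jumpTime_kill_ne_top {e : (n : ℕ) → Coord S n} {n : ℕ}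
    (h : jumpTime n (kill e) ≠ ∞) : ∀ i < n, e (i + 1) ≠ Coord.dead := by
  intro i hi hd
  have h1 : (kill e).1 (i + 1) = Coord.dead := kill_succ_of_dead le_rfl hd
  refine h (top_unique ?_)
  calc ∞ = sojourn i (kill e) := (sojourn_of_dead h1).symm
    _ ≤ jumpTime (i + 1) (kill e) := by rw [jumpTime_succ]; exact le_add_self
    _ ≤ jumpTime n (kill e) := jumpTime_mono _ hi

variable (e : (n : ℕ) → Coord S n) (n : ℕ) (c : Coord S (n + 1))

theorem kill_update_of_le : ∀ i ≤ n, (kill (Function.update e (n + 1) c)).1 i = (kill e).1 i :=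
  kill_congr fun i hi => Function.update_of_ne (by omega) _ _

theorem jumpTime_kill_update :
    jumpTime n (kill (Function.update e (n + 1) c)) = jumpTime n (kill e) :=
  jumpTime_congr (kill_update_of_le e n c)

theorem jumpState_kill_update :
    jumpState n (kill (Function.update e (n + 1) c)) = jumpState n (kill e) :=
  jumpState_congr (kill_update_of_le e n c)

variable {e n}

/-- Finiteness of T_n is needed: after an earlier (∞, x_∞) the inserted coordinate would be
overwritten. -/
theorem kill_update_self (h : jumpTime n (kill e) ≠ ∞) :
    (kill (Function.update e (n + 1) c)).1 (n + 1) = c := by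
  have h1 := ne_dead_of_jumpTime_kill_ne_top h
  by_cases hc : c = Coord.dead
  · rw [kill_succ_of_dead le_rfl (by rw [Function.update_self, hc]), hc]
  · rw [kill_succ_of_ne_dead, Function.update_self]
    intro i hi
    rcases hi.lt_or_eq with hi | rfl
    · rw [Function.update_of_ne (by omega)]
      exact h1 i hi
    · rwa [Function.update_self]

theorem jumpTime_kill_update_jump (h : jumpTime n (kill e) ≠ ∞) (p : Ioi (0 : ℝ) × S) :
    jumpTime (n + 1) (kill (Function.update e (n + 1) (Coord.jump p)))
      = jumpTime n (kill e) + ENNReal.ofReal p.1 := by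
  rw [jumpTime_succ, jumpTime_kill_update, sojourn, kill_update_self _ h]
  rfl

theorem jumpState_kill_update_jump (h : jumpTime n (kill e) ≠ ∞) (p : Ioi (0 : ℝ) × S) :
    jumpState (n + 1) (kill (Function.update e (n + 1) (Coord.jump p))) = Sum.inl p.2 := by
  rw [jumpState, kill_update_self _ h]
  rfl

variable (e n)

theorem jumpTime_kill_update_dead :
    jumpTime (n + 1) (kill (Function.update e (n + 1) Coord.dead)) = ∞ := by
  have h2 : (kill (Function.update e (n + 1) Coord.dead)).1 (n + 1) = Coord.dead :=
    kill_succ_of_dead le_rfl (Function.update_self _ _ _)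
  rw [jumpTime_succ, sojourn_of_dead h2, add_top]

end PathLemmas

/-! ### One-step conditioning for Ionescu-Tulcea measures -/

section Traj

variable {X : ℕ → Type*} [∀ n, MeasurableSpace (X n)]
  {κ : (n : ℕ) → Kernel ((i : Finset.Iic n) → X i) (X (n + 1))} [∀ n, IsMarkovKernel (κ n)]

/-- Under the trajectory kernel started from a history of length n, the first n coordinates are
frozen and coordinate n + 1 has law `κ n`; later coordinates do not matter for `G`. -/
theorem lintegral_traj_eq_of_dependsOn {n : ℕ} {G : ((n : ℕ) → X n) → ℝ≥0∞} (hG : Measurable G)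
    (hd : DependsOn G (Iic (n + 1))) (e : (n : ℕ) → X n) :
    ∫⁻ y, G y ∂Kernel.traj κ n (Preorder.frestrictLe n e)
      = ∫⁻ c, G (Function.update e (n + 1) c) ∂κ n (Preorder.frestrictLe n e) := by
  have hu : Measurable fun c => G (Function.update e (n + 1) c) :=
    hG.comp (measurable_update e)
  rw [Kernel.lintegral_traj _ hG, ← Kernel.map_traj_succ_self (κ := κ),
    Kernel.map_apply _ (measurable_pi_apply _), lintegral_map hu (measurable_pi_apply _)]
  refine lintegral_congr fun y => hd fun i hi => ?_
  rcases (mem_Iic.1 hi).lt_or_eq with hi | rfl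
  · have : i ≤ n := by omega
    simp [Function.updateFinset, this, hi.ne]
  · simp [Function.updateFinset]

/-- Integration over the trajectory, one coordinate after the other. -/
theorem lintegral_traj_succ {n : ℕ} {G : ((n : ℕ) → X n) → ℝ≥0∞} (hG : Measurable G)
    (hd : DependsOn G (Iic (n + 1))) (x : (i : Finset.Iic 0) → X i) :
    ∫⁻ e, G e ∂Kernel.traj κ 0 x
      = ∫⁻ e, ∫⁻ c, G (Function.update e (n + 1) c) ∂κ n (Preorder.frestrictLe n e)
          ∂Kernel.traj κ 0 x := by
  conv_lhs => rw [← Kernel.traj_comp_partialTraj (κ := κ) n.zero_le,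
    Kernel.lintegral_comp _ _ _ hG, ← Kernel.traj_map_frestrictLe,
    Kernel.map_apply _ (Preorder.measurable_frestrictLe n),
    lintegral_map hG.lintegral_kernel (Preorder.measurable_frestrictLe n)]
  exact lintegral_congr fun e => lintegral_traj_eq_of_dependsOn hG hd e

end Traj

/-! ### One-step conditioning under the law of the controlled process -/

section Law

variable {S A : Type*} [MeasurableSpace S] [MeasurableSpace A] {N : ℕ} [StandardBorelSpace S]
  {𝓜 : Model S A N}

theorem Policy.law_apply (π : Policy 𝓜) (x : S) :
    π.law x = (Kernel.traj π.step 0 (initialHistory x)).map kill := by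
  rw [law, Kernel.map_apply _ measurable_kill, Kernel.comap_apply]

instance (π : Policy 𝓜) : IsMarkovKernel π.law := by
  refine ⟨fun x => ?_⟩
  rw [π.law_apply]
  exact Measure.isProbabilityMeasure_map measurable_kill.aemeasurable

theorem Policy.lintegral_law (π : Policy 𝓜) (x : S) {F : Path S → ℝ≥0∞} (hF : Measurable F) :
    ∫⁻ p, F p ∂π.law x = ∫⁻ e, F (kill e) ∂Kernel.traj π.step 0 (initialHistory x) := by
  rw [π.law_apply, lintegral_map hF measurable_kill]

theorem Policy.lintegral_step (π : Policy 𝓜) (k : ℕ) (h : (i : Finset.Iic k) → Coord S i)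
    {g : Coord S (k + 1) → ℝ≥0∞} (hg : Measurable g) :
    ∫⁻ c, g c ∂π.step k h
      = ∫⁻ s, π.survival k h s * ∫⁻ y, g (Coord.jump (s, y)) ∂π.intensity k (h, s) ∂posLebesgue
        + π.survivalInfty k h * g Coord.dead := by
  have hm : Measurable fun s => π.survival k h s :=
    (π.measurable_survival k).comp measurable_prodMk_left
  have hI : Measurable (Function.uncurry fun (h : (i : Finset.Iic k) → Coord S i)
      (_ : Coord S (k + 1)) => π.survivalInfty k h) :=
    (π.measurable_survivalInfty k).comp measurable_fst
  have hJ : Measurable fun p : Ioi (0 : ℝ) × S => g (Coord.jump p) := hg.comp measurable_jump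
  rw [step, add_apply, lintegral_add_measure, Kernel.map_apply _ measurable_jump,
    lintegral_map hg measurable_jump, Kernel.lintegral_compProd _ _ _ hJ,
    Kernel.withDensity_apply _ (π.measurable_survival k),
    Kernel.withDensity_apply _ hI, withDensity_const, Kernel.const_apply, Kernel.const_apply,
    lintegral_smul_measure, lintegral_dirac' _ hg,
    lintegral_withDensity_eq_lintegral_mul _ hm]
  · rfl
  · have : Measurable (Function.uncurry fun (s : Ioi (0 : ℝ)) (y : S) => g (Coord.jump (s, y))) := hJ
    exact Measurable.lintegral_kernel_prod_right
      (κ := (π.intensity k).comap (Prod.mk h) measurable_prodMk_left) this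

theorem Policy.lintegral_intensity (π : Policy 𝓜) (k : ℕ)
    (p : ((i : Finset.Iic k) → Coord S i) × Ioi (0 : ℝ)) {g : S → ℝ≥0∞} (hg : Measurable g) :
    ∫⁻ y, g y ∂π.intensity k p
      = ∫⁻ a, ∫⁻ y, g y ∂𝓜.jumpRate (jumpState k (stopped k p.1), a) ∂π.actAfter k p := by
  rw [intensity, Kernel.lintegral_comp _ _ _ hg, Kernel.prod_apply, Kernel.deterministic_apply,
    Measure.dirac_prod, lintegral_map hg.lintegral_kernel measurable_prodMk_left]

theorem Policy.measurable_intensity_univ (π : Policy 𝓜) (k : ℕ)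
    (h : (i : Finset.Iic k) → Coord S i) :
    Measurable fun s => π.intensity k (h, s) univ :=
  ((π.intensity k).measurable_coe MeasurableSet.univ).comp measurable_prodMk_left

theorem Policy.intensity_le (π : Policy 𝓜) (k : ℕ) {h : (i : Finset.Iic k) → Coord S i} {C : ℝ≥0}
    (hC : ∀ a, 𝓜.jumpRate (jumpState k (stopped k h), a) univ ≤ C) (s : Ioi (0 : ℝ)) :
    π.intensity k (h, s) univ ≤ C := by
  rw [π.intensity_apply k _ MeasurableSet.univ]
  refine (lintegral_mono fun a => hC a).trans ?_
  simp

/-- The drift inequality for jump measures is linear in the rates apart from a constant, so it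
survives averaging over the randomized action. -/
theorem GrowthCondition.lintegral_intensity_le [TopologicalSpace S] [BorelSpace S]
    {w : S → ℝ} {ρ b : ℝ} {Sk : ℕ → Set S} (hA : GrowthCondition 𝓜 w ρ b Sk) (π : Policy 𝓜)
    {k : ℕ} {h : (i : Finset.Iic k) → Coord S i} {x : S}
    (hx : jumpState k (stopped k h) = Sum.inl x) (s : Ioi (0 : ℝ)) :
    ∫⁻ y, ENNReal.ofReal (w y) ∂π.intensity k (h, s)
      ≤ ENNReal.ofReal (ρ * w x + b) + π.intensity k (h, s) univ * ENNReal.ofReal (w x) := by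
  have hw : Measurable fun y => ENNReal.ofReal (w y) := hA.continuous_w.measurable.ennreal_ofReal
  have h1 : π.intensity k (h, s) univ
      = ∫⁻ a, 𝓜.jumpRate (Sum.inl x, a) univ ∂π.actAfter k (h, s) := by
    have := π.lintegral_intensity k (h, s) (g := fun _ => 1) measurable_const
    simpa [hx] using this
  have hm : Measurable fun a : A ⊕ Unit => 𝓜.jumpRate (Sum.inl x, a) univ :=
    (Kernel.measurable_coe _ MeasurableSet.univ).comp measurable_prodMk_left
  rw [π.lintegral_intensity k (h, s) hw, h1]
  simp only [hx]
  refine (lintegral_mono fun a => hA.lintegral_jumpRate_le x a).trans ?_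
  rw [lintegral_add_left measurable_const, lintegral_mul_const _ hm]
  simp

/-- A comparison of expectations follows from the comparison of the conditional expectations
given the first `n` jumps. -/
theorem Policy.lintegral_law_le (π : Policy 𝓜) (x : S) (n : ℕ) {F F' : Path S → ℝ≥0∞}
    (hF : Measurable F) (hF' : Measurable F')
    (hd : ∀ p p' : Path S, (∀ i ≤ n + 1, p.1 i = p'.1 i) → F p = F p')
    (h : ∀ e, ∫⁻ c, F (kill (Function.update e (n + 1) c)) ∂π.step n (Preorder.frestrictLe n e)
      ≤ F' (kill e)) :
    ∫⁻ p, F p ∂π.law x ≤ ∫⁻ p, F' p ∂π.law x := by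
  rw [π.lintegral_law x hF, π.lintegral_law x hF']
  exact lintegral_traj_succ (G := fun e => F (kill e)) (n := n) (hF.comp measurable_kill)
    (fun e e' he => hd _ _ (kill_congr he)) _ |>.trans_le (lintegral_mono h)

theorem Policy.lintegral_kill_update (π : Policy 𝓜) {F : Path S → ℝ≥0∞} (hF : Measurable F)
    (n : ℕ) (e : (n : ℕ) → Coord S n) (h : (i : Finset.Iic n) → Coord S i) :
    ∫⁻ c, F (kill (Function.update e (n + 1) c)) ∂π.step n h
      = ∫⁻ s, π.survival n h s * ∫⁻ y, F (kill (Function.update e (n + 1) (Coord.jump (s, y))))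
          ∂π.intensity n (h, s) ∂posLebesgue
        + π.survivalInfty n h * F (kill (Function.update e (n + 1) Coord.dead)) :=
  π.lintegral_step n h (g := fun c => F (kill (Function.update e (n + 1) c)))
    (hF.comp (measurable_kill.comp (measurable_update e)))

end Law

/-! ### One-jump supermartingale inequalities -/

section Lyapunov

variable {S A : Type*}

/-- `growthBound` at time `t`, started at the jump `(T_n, X_n)`, on `T_n ≤ t`. -/
noncomputable def jumpBound (w : S → ℝ) (ρ b : ℝ) (t : ℝ≥0) (n : ℕ) (p : Path S) : ℝ≥0∞ :=
  {p | jumpTime n p ≤ t}.indicator (fun p =>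
    extState (fun x => growthBound ρ b (t - (jumpTime n p).toReal) (w x)) (jumpState n p)) p

/-- `w(X_n)` on `T_n ≤ t < T_{n+1}`. -/
noncomputable def sojournWeight (w : S → ℝ) (t : ℝ≥0) (n : ℕ) (p : Path S) : ℝ≥0∞ :=
  {p | jumpTime n p ≤ t ∧ t < jumpTime (n + 1) p}.indicator
    (fun p => extState w (jumpState n p)) p

/-- `exp (-T_n)` on `T_n ≤ t`. -/
noncomputable def jumpDiscount (t : ℝ≥0) (n : ℕ) (p : Path S) : ℝ≥0∞ :=
  {p | jumpTime n p ≤ t}.indicator (fun p => ENNReal.ofReal (Real.exp (-(jumpTime n p).toReal))) p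

theorem jumpBound_congr (w : S → ℝ) (ρ b : ℝ) (t : ℝ≥0) {n : ℕ} {p p' : Path S}
    (h : ∀ i ≤ n, p.1 i = p'.1 i) : jumpBound w ρ b t n p = jumpBound w ρ b t n p' := by
  simp only [jumpBound, indicator, mem_ofPred_eq, jumpTime_congr h, jumpState_congr h]

theorem sojournWeight_congr (w : S → ℝ) (t : ℝ≥0) {n : ℕ} {p p' : Path S}
    (h : ∀ i ≤ n + 1, p.1 i = p'.1 i) : sojournWeight w t n p = sojournWeight w t n p' := by
  have h' : ∀ i ≤ n, p.1 i = p'.1 i := fun i hi => h i (by omega)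
  simp only [sojournWeight, indicator, mem_ofPred_eq, jumpTime_congr h, jumpTime_congr h',
    jumpState_congr h']

theorem jumpDiscount_congr (t : ℝ≥0) {n : ℕ} {p p' : Path S}
    (h : ∀ i ≤ n, p.1 i = p'.1 i) : jumpDiscount t n p = jumpDiscount t n p' := by
  simp only [jumpDiscount, indicator, mem_ofPred_eq, jumpTime_congr h]

theorem stopped_frestrictLe_state (e : (n : ℕ) → Coord S n) (n : ℕ) :
    jumpState n (stopped n (Preorder.frestrictLe n e)) = jumpState n (kill e) :=
  jumpState_congr (stopped_frestrictLe e n)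

variable [MeasurableSpace S] [MeasurableSpace A] {N : ℕ}

theorem measurable_extState {w : S → ℝ} (hw : Measurable w) : Measurable (extState w) :=
  measurable_fun_sum hw.ennreal_ofReal measurable_const

theorem measurable_jumpBound {w : S → ℝ} (hw : Measurable w) (ρ b : ℝ) (t : ℝ≥0) (n : ℕ) :
    Measurable (jumpBound w ρ b t n) := by
  refine Measurable.indicator ?_ (measurable_jumpTime n measurableSet_Iic)
  have h1 : Measurable fun q : ℝ × S => ENNReal.ofReal (growthBound ρ b q.1 (w q.2)) :=
    ((continuous_growthBound ρ b).measurable.comp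
      (measurable_fst.prodMk (hw.comp measurable_snd))).ennreal_ofReal
  have h2 : Measurable fun q : ℝ × (S ⊕ Unit) =>
      extState (fun x => growthBound ρ b q.1 (w x)) q.2 := by
    have h3 : Measurable fun q : (ℝ × S) ⊕ (ℝ × Unit) =>
        Sum.elim (fun q : ℝ × S => ENNReal.ofReal (growthBound ρ b q.1 (w q.2)))
          (fun _ => 0) q := measurable_fun_sum h1 measurable_const
    convert h3.comp (MeasurableEquiv.prodSumDistrib ℝ S Unit).measurable using 1
    funext ⟨r, q⟩
    rcases q with q | q <;> rfl
  exact h2.comp ((measurable_const.sub (measurable_jumpTime n).ennreal_toReal).prodMk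
    (measurable_jumpState n))

theorem measurable_sojournWeight {w : S → ℝ} (hw : Measurable w) (t : ℝ≥0) (n : ℕ) :
    Measurable (sojournWeight w t n) :=
  ((measurable_extState hw).comp (measurable_jumpState n)).indicator
    ((measurable_jumpTime n measurableSet_Iic).inter
      (measurable_jumpTime (n + 1) measurableSet_Ioi))

theorem measurable_jumpDiscount (t : ℝ≥0) (n : ℕ) : Measurable (jumpDiscount (S := S) t n) :=
  ((measurable_jumpTime n).ennreal_toReal.neg.exp.ennreal_ofReal).indicator
    (measurable_jumpTime n measurableSet_Iic)

variable [StandardBorelSpace S] {𝓜 : Model S A N}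

/-- The key supermartingale step: given the first n jumps, either the next jump occurs by time t and
the bound restarts from there, or the process is still in X_n at t and contributes w(X_n). The
one-sojourn estimate `lintegral_growthBound_le` covers both. -/
theorem GrowthCondition.lintegral_step_le [TopologicalSpace S] [BorelSpace S]
    {w : S → ℝ} {ρ b : ℝ} {Sk : ℕ → Set S} (hA : GrowthCondition 𝓜 w ρ b Sk) (π : Policy 𝓜)
    (t : ℝ≥0) (n : ℕ) (e : (n : ℕ) → Coord S n) :
    ∫⁻ c, (jumpBound w ρ b t (n + 1) (kill (Function.update e (n + 1) c))
        + sojournWeight w t n (kill (Function.update e (n + 1) c)))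
        ∂π.step n (Preorder.frestrictLe n e)
      ≤ jumpBound w ρ b t n (kill e) := by
  have hw := hA.continuous_w.measurable
  have hw0 : ∀ y, 0 ≤ w y := fun y => zero_le_one.trans (hA.one_le_w y)
  by_cases ht : jumpTime n (kill e) ≤ t
  swap
  -- If T_n > t, then T_{n+1} > t as well, and both terms vanish.
  · refine (lintegral_eq_zero_iff' ?_).2 (ae_of_all _ fun c => ?_) |>.trans_le (zero_le)
    · exact (((measurable_jumpBound hw ρ b t (n + 1)).add
        (measurable_sojournWeight hw t n)).comp (measurable_kill.comp (measurable_update e))).aemeasurable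
    · have h1 : ¬ jumpTime n (kill (Function.update e (n + 1) c)) ≤ t := by
        rwa [jumpTime_kill_update]
      have h2 : ¬ jumpTime (n + 1) (kill (Function.update e (n + 1) c)) ≤ t := fun h =>
        h1 ((jumpTime_mono _ n.le_succ).trans h)
      simp [jumpBound, sojournWeight, h1, h2]
  have hne : jumpTime n (kill e) ≠ ∞ := (ht.trans_lt ENNReal.coe_lt_top).ne
  obtain ⟨x, hx⟩ := exists_jumpState_eq_inl hne
  set τ : ℝ := (jumpTime n (kill e)).toReal with hτ
  have hτe : jumpTime n (kill e) = ENNReal.ofReal τ := (ENNReal.ofReal_toReal hne).symm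
  have hτ0 : 0 ≤ τ := ENNReal.toReal_nonneg
  set u : ℝ := t - τ with hu
  have hτt : τ ≤ t := by
    have := ENNReal.toReal_mono ENNReal.coe_ne_top ht
    simpa using this
  have hu0 : 0 ≤ u := sub_nonneg.2 hτt
  set h := Preorder.frestrictLe n e with hh
  have hxs : jumpState n (stopped n h) = Sum.inl x := by rw [hh, stopped_frestrictLe_state, hx]
  obtain ⟨C, hC⟩ := 𝓜.jumpRate_bound (jumpState n (stopped n h))
  have hm := π.measurable_intensity_univ n h
  have hmC := π.intensity_le n hC
  have hus : MeasurableSet {s : Ioi (0 : ℝ) | (s : ℝ) ≤ u} :=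
    measurable_subtype_coe measurableSet_Iic
  have hRHS : jumpBound w ρ b t n (kill e) = ENNReal.ofReal (growthBound ρ b u (w x)) := by
    simp [jumpBound, ht, hx, extState, ← hτ, ← hu]
  have hTs : ∀ (s : Ioi (0 : ℝ)) (y : S),
      jumpTime (n + 1) (kill (Function.update e (n + 1) (Coord.jump (s, y))))
        = ENNReal.ofReal (τ + s) := fun s y => by
    rw [jumpTime_kill_update_jump hne, hτe, ENNReal.ofReal_add hτ0 (le_of_lt s.2)]
  have hle : ∀ s : Ioi (0 : ℝ), ENNReal.ofReal (τ + s) ≤ t ↔ (s : ℝ) ≤ u := fun s => by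
    rw [← ENNReal.ofReal_coe_nnreal, ENNReal.ofReal_le_ofReal_iff t.coe_nonneg, hu, le_sub_iff_add_le']
  have hJ : ∀ (s : Ioi (0 : ℝ)) (y : S),
      jumpBound w ρ b t (n + 1) (kill (Function.update e (n + 1) (Coord.jump (s, y))))
        + sojournWeight w t n (kill (Function.update e (n + 1) (Coord.jump (s, y))))
      = if (s : ℝ) ≤ u then ENNReal.ofReal (growthBound ρ b (u - s) (w y))
        else ENNReal.ofReal (w x) := fun s y => by
    have h3 : (ENNReal.ofReal (τ + s)).toReal = τ + s :=
      ENNReal.toReal_ofReal (add_nonneg hτ0 (le_of_lt s.2))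
    by_cases hs : (s : ℝ) ≤ u
    · have h1 := (hle s).2 hs
      rw [if_pos hs]
      simp [jumpBound, sojournWeight, hTs, h1, not_lt.2 h1, h3, extState,
        jumpState_kill_update_jump hne, hu, sub_sub]
    · have h1 := mt (hle s).1 hs
      simp [jumpBound, sojournWeight, hTs, h1, not_le.1 h1, hs, jumpTime_kill_update, ht,
        jumpState_kill_update, hx, extState]
  have hD : jumpBound w ρ b t (n + 1) (kill (Function.update e (n + 1) Coord.dead))
        + sojournWeight w t n (kill (Function.update e (n + 1) Coord.dead))
      = ENNReal.ofReal (w x) := by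
    simp [jumpBound, sojournWeight, jumpTime_kill_update_dead, jumpTime_kill_update, ht,
        jumpState_kill_update, hx, extState]
  rw [π.lintegral_kill_update (F := fun p => jumpBound w ρ b t (n + 1) p + sojournWeight w t n p)
    ((measurable_jumpBound hw ρ b t (n + 1)).add (measurable_sojournWeight hw t n)), hRHS]
  simp only [hJ, hD]
  refine le_trans (le_of_eq ?_) (lintegral_growthBound_le (fun s => π.intensity n (h, s)) C hm hmC
    hw hw0 hA.rho_nonneg hA.b_nonneg (hw0 x) hu0
    (fun s => hA.lintegral_intensity_le π hxs s))
  -- A next jump after t and no further jump both contribute w(x); together they have the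
  -- probability of surviving the remaining time u.
  rw [← lintegral_hazard_tail _ C hm hmC hu0, ← lintegral_add_compl _ hus, add_mul, add_assoc]
  congr 1
  · refine setLIntegral_congr_fun hus fun s hs => ?_
    have hs' : (s : ℝ) ≤ u := hs
    simp only [hs', if_true, Policy.survival]
  · congr 1
    rw [← lintegral_mul_const']
    · refine setLIntegral_congr_fun hus.compl fun s hs => ?_
      have hs' : ¬ (s : ℝ) ≤ u := hs
      simp only [hs', if_false, Policy.survival, lintegral_const]
      ring
    · exact ENNReal.ofReal_ne_top

/-- Bounded rates cannot make jumps arrive too fast: from a state whose rate is at most C, the next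
sojourn discounts exp(-T_n) in the mean by at least the factor 1 + 1/C. -/
theorem Policy.lintegral_step_jumpDiscount_le (π : Policy 𝓜) (t : ℝ≥0) (n : ℕ)
    (e : (n : ℕ) → Coord S n) {C : ℝ≥0} (hC0 : C ≠ 0)
    (hC : ∀ a, 𝓜.jumpRate (jumpState n (kill e), a) univ ≤ C) :
    (1 + (C : ℝ≥0∞)⁻¹) * ∫⁻ c, jumpDiscount t (n + 1) (kill (Function.update e (n + 1) c))
        ∂π.step n (Preorder.frestrictLe n e) ≤ jumpDiscount t n (kill e) := by
  by_cases ht : jumpTime n (kill e) ≤ t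
  swap
  · have : ∫⁻ c, jumpDiscount t (n + 1) (kill (Function.update e (n + 1) c))
        ∂π.step n (Preorder.frestrictLe n e) = 0 := by
      refine (lintegral_eq_zero_iff' ?_).2 (ae_of_all _ fun c => ?_)
      · exact ((measurable_jumpDiscount t (n + 1)).comp
          (measurable_kill.comp (measurable_update e))).aemeasurable
      · have h1 : ¬ jumpTime n (kill (Function.update e (n + 1) c)) ≤ t := by
          rwa [jumpTime_kill_update]
        have h2 : ¬ jumpTime (n + 1) (kill (Function.update e (n + 1) c)) ≤ t := fun h =>
          h1 ((jumpTime_mono _ n.le_succ).trans h)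
        simp [jumpDiscount, h2]
    rw [this, mul_zero]; exact zero_le
  have hne : jumpTime n (kill e) ≠ ∞ := (ht.trans_lt ENNReal.coe_lt_top).ne
  set τ : ℝ := (jumpTime n (kill e)).toReal with hτ
  have hτe : jumpTime n (kill e) = ENNReal.ofReal τ := (ENNReal.ofReal_toReal hne).symm
  have hτ0 : 0 ≤ τ := ENNReal.toReal_nonneg
  set u : ℝ := t - τ with hu
  have hτt : τ ≤ t := by
    have := ENNReal.toReal_mono ENNReal.coe_ne_top ht
    simpa using this
  have hu0 : 0 ≤ u := sub_nonneg.2 hτt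
  set h := Preorder.frestrictLe n e with hh
  have hm := π.measurable_intensity_univ n h
  have hmC := π.intensity_le n (h := h) (by rw [hh, stopped_frestrictLe_state]; exact hC)
  have hus : MeasurableSet {s : Ioi (0 : ℝ) | (s : ℝ) ≤ u} :=
    measurable_subtype_coe measurableSet_Iic
  have hJ : ∀ (s : Ioi (0 : ℝ)) (y : S),
      jumpDiscount t (n + 1) (kill (Function.update e (n + 1) (Coord.jump (s, y))))
      = {s : Ioi (0 : ℝ) | (s : ℝ) ≤ u}.indicator
        (fun s => ENNReal.ofReal (Real.exp (-τ)) * ENNReal.ofReal (Real.exp (-s))) s := fun s y => by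
    have h3 : (ENNReal.ofReal (τ + s)).toReal = τ + s :=
      ENNReal.toReal_ofReal (add_nonneg hτ0 (le_of_lt s.2))
    have h4 : ENNReal.ofReal (τ + s) ≤ t ↔ (s : ℝ) ≤ u := by
      rw [← ENNReal.ofReal_coe_nnreal, ENNReal.ofReal_le_ofReal_iff t.coe_nonneg, hu, le_sub_iff_add_le']
    simp only [jumpDiscount, indicator, mem_ofPred_eq, jumpTime_kill_update_jump hne]
    rw [hτe, ← ENNReal.ofReal_add hτ0 (le_of_lt s.2), h3, ← ENNReal.ofReal_mul (Real.exp_pos _).le,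
      ← Real.exp_add, neg_add]
    simp only [h4]
  have hD : jumpDiscount t (n + 1) (kill (Function.update e (n + 1) Coord.dead)) = 0 := by
    simp [jumpDiscount, jumpTime_kill_update_dead]
  rw [π.lintegral_kill_update (measurable_jumpDiscount t (n + 1))]
  simp only [hJ, hD, mul_zero, add_zero, lintegral_const]
  have hRHS : jumpDiscount t n (kill e) = ENNReal.ofReal (Real.exp (-τ)) := by
    simp [jumpDiscount, ht, ← hτ]
  have key := lintegral_exp_neg_le _ hC0 hm hmC hu0
  rw [hRHS]
  calc _ = ENNReal.ofReal (Real.exp (-τ)) * ((1 + (C : ℝ≥0∞)⁻¹)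
          * ∫⁻ s in {s : Ioi (0 : ℝ) | (s : ℝ) ≤ u},
            expNeg (∫⁻ v in Iic s, π.intensity n (h, v) univ ∂posLebesgue)
              * (π.intensity n (h, s) univ * ENNReal.ofReal (Real.exp (-s))) ∂posLebesgue) := by
        rw [mul_left_comm, ← lintegral_const_mul' _ _ ENNReal.ofReal_ne_top,
          ← lintegral_indicator hus]
        congr 1
        refine lintegral_congr fun s => ?_
        by_cases hs : s ∈ {s : Ioi (0 : ℝ) | (s : ℝ) ≤ u}
        · simp only [indicator_of_mem hs, Policy.survival]; ring
        · simp only [indicator_of_notMem hs, zero_mul, mul_zero]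
    _ ≤ ENNReal.ofReal (Real.exp (-τ)) * 1 := by gcongr
    _ = _ := mul_one _

theorem posLebesgue_singleton (s : Ioi (0 : ℝ)) : posLebesgue {s} = 0 := by
  rw [posLebesgue, (MeasurableEmbedding.subtype_coe measurableSet_Ioi).comap_apply]
  simp

/-- The jump epochs have no atoms. -/
theorem Policy.ae_jumpTime_ne (π : Policy 𝓜) (x : S) (t : ℝ≥0) (n : ℕ) :
    ∀ᵐ p ∂π.law x, jumpTime (n + 1) p ≠ t := by
  have hms : MeasurableSet {p : Path S | jumpTime (n + 1) p = t} :=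
    measurable_jumpTime (n + 1) (measurableSet_singleton _)
  have hF : Measurable ({p : Path S | jumpTime (n + 1) p = t}.indicator (1 : Path S → ℝ≥0∞)) :=
    measurable_one.indicator hms
  have hle := π.lintegral_law_le x n hF (F' := fun _ => 0) measurable_const (fun p p' hp => by
    simp [indicator, jumpTime_congr hp]) (fun e => by
    rw [π.lintegral_kill_update hF]
    refine le_of_eq (add_eq_zero.2 ⟨?_, ?_⟩)
    · by_cases hne : jumpTime n (kill e) = ∞
      · have : ∀ c, jumpTime (n + 1) (kill (Function.update e (n + 1) c)) ≠ t := fun c h => by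
          rw [jumpTime_succ, jumpTime_kill_update, hne, top_add] at h
          exact ENNReal.coe_ne_top h.symm
        simp [this]
      have h0 : ∀ᵐ s ∂posLebesgue, s ∉
          {s : Ioi (0 : ℝ) | jumpTime n (kill e) + ENNReal.ofReal s = t} := by
        refine measure_eq_zero_iff_ae_notMem.1 ?_
        -- Given a finite T_n, only one sojourn length puts the next jump exactly at t, and the
        -- conditional law of the sojourn has a Lebesgue density on (0, ∞).
        have hsub : {s : Ioi (0 : ℝ) | jumpTime n (kill e) + ENNReal.ofReal s = t}.Subsingleton := by
          intro s hs s' hs'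
          have := (ENNReal.add_right_inj hne).1 (hs.trans hs'.symm)
          exact Subtype.ext ((ENNReal.ofReal_eq_ofReal_iff (le_of_lt s.2) (le_of_lt s'.2)).1 this)
        rcases hsub.eq_empty_or_singleton with h | ⟨s, h⟩
        · rw [h]; exact measure_empty
        · rw [h]; exact posLebesgue_singleton s
      refine (lintegral_congr_ae ?_).trans lintegral_zero
      filter_upwards [h0] with s hs
      have : ∀ y, jumpTime (n + 1) (kill (Function.update e (n + 1) (Coord.jump (s, y)))) ≠ t :=
        fun y => by rw [jumpTime_kill_update_jump hne]; exact hs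
      simp [this]
    · simp [jumpTime_kill_update_dead])
  rw [lintegral_indicator_one hms, lintegral_zero] at hle
  exact measure_eq_zero_iff_ae_notMem.1 (le_antisymm hle zero_le)

end Lyapunov

/-! ### Moment bound, maximal inequality and nonexplosion -/

section Moments

theorem _root_.ENNReal.eq_zero_of_forall_nat_mul_le {a K : ℝ≥0∞} (hK : K ≠ ∞)
    (h : ∀ n : ℕ, n * a ≤ K) : a = 0 := by
  by_contra ha
  obtain ⟨n, hn⟩ := ENNReal.exists_nat_mul_gt ha hK
  exact (h n).not_gt hn

/-- A form of Bernoulli's inequality: it weakens geometric decay to 1/n, which still forces a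
probability to be 0. -/
theorem _root_.ENNReal.nat_mul_le_one_add_pow (c : ℝ≥0∞) (n : ℕ) : n * c ≤ (1 + c) ^ n := by
  induction n with
  | zero => simp
  | succ n ih =>
    have h1 : 1 ≤ (1 + c) ^ n := one_le_pow₀ le_self_add
    calc ((n + 1 : ℕ) : ℝ≥0∞) * c = n * c + c * 1 := by push_cast; ring
      _ ≤ (1 + c) ^ n + c * (1 + c) ^ n := by gcongr
      _ = _ := by ring

variable {S A : Type*}

/-- The Borel set of paths whose states up to the `(n-1)`-th jump lie in `{w ≤ j}`. -/
def sublevelPath (w : S → ℝ) (j : ℝ≥0) (n : ℕ) : Set (Path S) :=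
  {p | ∀ i < n, extState w (jumpState i p) ≤ j}

theorem mem_sublevelPath_congr (w : S → ℝ) (j : ℝ≥0) {n : ℕ} {p p' : Path S}
    (h : ∀ i ≤ n, p.1 i = p'.1 i) :
    p ∈ sublevelPath w j (n + 1) ↔ p' ∈ sublevelPath w j (n + 1) :=
  forall_congr' fun i => imp_congr_right fun hi => by
    rw [jumpState_congr fun k (hk : k ≤ i) => h k (by omega)]

theorem indicator_sublevelPath_congr (w : S → ℝ) (j : ℝ≥0) {n : ℕ} {p p' : Path S}
    (h : ∀ i ≤ n, p.1 i = p'.1 i) :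
    (sublevelPath w j (n + 1)).indicator (1 : Path S → ℝ≥0∞) p
      = (sublevelPath w j (n + 1)).indicator 1 p' := by
  have hiff := mem_sublevelPath_congr w j h
  by_cases hp : p ∈ sublevelPath w j (n + 1)
  · rw [indicator_of_mem hp, indicator_of_mem (hiff.1 hp)]; rfl
  · rw [indicator_of_notMem hp, indicator_of_notMem (mt hiff.2 hp)]

/-- If ξ_t is in S, the sojourn interval containing t supplies a term equal to w(ξ_t); at x_∞ the
left side is 0. -/
theorem extState_stateAt_le_tsum (w : S → ℝ) (t : ℝ≥0) (p : Path S) :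
    extState w (stateAt t p) ≤ ∑' n, sojournWeight w t n p := by
  classical
  unfold stateAt
  split_ifs with h
  · refine le_trans (le_of_eq ?_) (ENNReal.le_tsum (Nat.find h))
    rw [sojournWeight, indicator_of_mem]
    exact Nat.find_spec h
  · exact zero_le

variable [MeasurableSpace S]

theorem measurableSet_sublevelPath {w : S → ℝ} (hw : Measurable w) (j : ℝ≥0) (n : ℕ) :
    MeasurableSet (sublevelPath w j n) := by
  have : sublevelPath w j n = ⋂ i ∈ Iio n, {p | extState w (jumpState i p) ≤ j} := by
    ext p; simp [sublevelPath]
  rw [this]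
  exact MeasurableSet.biInter (to_countable _) fun i _ =>
    ((measurable_extState hw).comp (measurable_jumpState i)) measurableSet_Iic

variable [MeasurableSpace A] {N : ℕ} [StandardBorelSpace S]
  {𝓜 : Model S A N}

theorem Policy.lintegral_law_of_initial (π : Policy 𝓜) (x : S) {F : Path S → ℝ≥0∞}
    (hF : Measurable F) {c : ℝ≥0∞} (h : ∀ p : Path S, jumpState 0 p = Sum.inl x → F p = c) :
    ∫⁻ p, F p ∂π.law x = c := by
  rw [π.lintegral_law x hF]
  refine (Kernel.lintegral_traj (initialHistory x) (hF.comp measurable_kill)).trans ?_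
  refine (lintegral_congr fun e => h _ ?_).trans (by simp)
  rfl

/-- Geometric decay by iterating the one-jump discount. The n-th epoch involves sojourns in X_0, …,
X_{n-1} only, hence the restriction to indices below n. -/
theorem Policy.lintegral_sublevelPath_jumpDiscount_le (π : Policy 𝓜) {w : S → ℝ}
    (hw : Measurable w) {j C : ℝ≥0} (hC0 : C ≠ 0)
    (hC : ∀ x, w x ≤ j → ∀ a, 𝓜.jumpRate (Sum.inl x, a) univ ≤ C) (x : S) (t : ℝ≥0) (n : ℕ) :
    (1 + (C : ℝ≥0∞)⁻¹) ^ n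
      * ∫⁻ p, (sublevelPath w j n).indicator 1 p * jumpDiscount t n p ∂π.law x ≤ 1 := by
  have hmeas : ∀ m n, Measurable fun p =>
      (sublevelPath w j m).indicator (1 : Path S → ℝ≥0∞) p * jumpDiscount t n p := fun m n =>
    (measurable_one.indicator (measurableSet_sublevelPath hw j m)).mul (measurable_jumpDiscount t n)
  induction n with
  | zero =>
    rw [pow_zero, one_mul]
    refine (lintegral_mono (g := fun _ => 1) fun p => ?_).trans (by simp)
    simp [sublevelPath, jumpDiscount, jumpTime]
  | succ n ih =>
    refine le_trans ?_ ih
    rw [pow_succ, mul_assoc]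
    gcongr
    rw [← lintegral_const_mul _ (hmeas _ _)]
    refine π.lintegral_law_le x n ((hmeas _ _).const_mul _) (hmeas _ _) (fun p p' hp => ?_)
      fun e => ?_
    · rw [indicator_sublevelPath_congr w j fun i hi => hp i (by omega), jumpDiscount_congr t hp]
    · have hH : ∀ c, (sublevelPath w j (n + 1)).indicator (1 : Path S → ℝ≥0∞)
          (kill (Function.update e (n + 1) c))
          = (sublevelPath w j (n + 1)).indicator 1 (kill e) := fun c =>
        indicator_sublevelPath_congr w j (kill_update_of_le e n c)
      simp only [hH]
      by_cases he : kill e ∈ sublevelPath w j (n + 1)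
      · have he' : kill e ∈ sublevelPath w j n := fun i hi => he i (by omega)
        simp only [indicator_of_mem he, indicator_of_mem he', Pi.one_apply, one_mul]
        rw [lintegral_const_mul' _ _ (by simp [hC0])]
        refine π.lintegral_step_jumpDiscount_le t n e hC0 fun a => ?_
        rcases hx : jumpState n (kill e) with y | y
        · refine hC y ?_ a
          have := he n (Nat.lt_succ_self n)
          rw [hx] at this
          change ENNReal.ofReal (w y) ≤ j at this
          rwa [← ENNReal.ofReal_coe_nnreal, ENNReal.ofReal_le_ofReal_iff j.coe_nonneg] at this
        -- At x_∞ there are no jumps, so any bound on the rate holds.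
        · rw [𝓜.jumpRate_of_notMem]
          · simp
          · rintro ⟨z, hz⟩
            simpa [Model.incl] using congrArg Prod.fst hz
      · simp [indicator_of_notMem he]

variable [TopologicalSpace S] [BorelSpace S] {w : S → ℝ} {ρ b : ℝ} {Sk : ℕ → Set S}

/-- The weight `H` is known after n jumps and so passes through the conditional expectation. Taking
`H = 1` gives the moment bound; taking the indicator of not yet having left {w ≤ j} gives the
stopped process. -/
theorem GrowthCondition.lintegral_mul_jumpBound_le (hA : GrowthCondition 𝓜 w ρ b Sk)
    (π : Policy 𝓜) (x : S) (t : ℝ≥0) (n : ℕ) {H : Path S → ℝ≥0∞} (hH : Measurable H)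
    (hHd : ∀ p p' : Path S, (∀ i ≤ n, p.1 i = p'.1 i) → H p = H p') :
    ∫⁻ p, H p * (jumpBound w ρ b t (n + 1) p + sojournWeight w t n p) ∂π.law x
      ≤ ∫⁻ p, H p * jumpBound w ρ b t n p ∂π.law x := by
  have hw := hA.continuous_w.measurable
  have hm : Measurable fun p => jumpBound w ρ b t (n + 1) p + sojournWeight w t n p :=
    (measurable_jumpBound hw ρ b t (n + 1)).add (measurable_sojournWeight hw t n)
  refine π.lintegral_law_le x n (hH.mul hm) (hH.mul (measurable_jumpBound hw ρ b t n))
    (fun p p' hp => ?_) fun e => ?_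
  · rw [hHd p p' fun i hi => hp i (by omega), jumpBound_congr w ρ b t hp,
      sojournWeight_congr w t hp]
  · simp only [hHd _ _ (kill_update_of_le e n _)]
    have hm' : Measurable fun c =>
        jumpBound w ρ b t (n + 1) (kill (Function.update e (n + 1) c))
          + sojournWeight w t n (kill (Function.update e (n + 1) c)) :=
      hm.comp (measurable_kill.comp (measurable_update e))
    rw [lintegral_const_mul _ hm']
    gcongr
    exact hA.lintegral_step_le π t n e

theorem GrowthCondition.lintegral_jumpBound_zero (hA : GrowthCondition 𝓜 w ρ b Sk)
    (π : Policy 𝓜) (x : S) (t : ℝ≥0) :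
    ∫⁻ p, jumpBound w ρ b t 0 p ∂π.law x = ENNReal.ofReal (growthBound ρ b t (w x)) :=
  π.lintegral_law_of_initial x (measurable_jumpBound hA.continuous_w.measurable ρ b t 0)
    fun p hp => by simp [jumpBound, jumpTime, hp, extState]

/-- Telescoping the supermartingale inequality and discarding the term of the n-th jump leaves the
sum over sojourns, which dominates E[w(ξ_t)]. -/
theorem GrowthCondition.lintegral_stateAt_le (hA : GrowthCondition 𝓜 w ρ b Sk)
    (π : Policy 𝓜) (x : S) (t : ℝ≥0) :
    ∫⁻ p, extState w (stateAt t p) ∂π.law x ≤ ENNReal.ofReal (growthBound ρ b t (w x)) := by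
  have hw := hA.continuous_w.measurable
  have key : ∀ n, ∫⁻ p, jumpBound w ρ b t n p ∂π.law x
      + ∑ k ∈ Finset.range n, ∫⁻ p, sojournWeight w t k p ∂π.law x
      ≤ ENNReal.ofReal (growthBound ρ b t (w x)) := fun n => by
    induction n with
    | zero => simp [hA.lintegral_jumpBound_zero π x t]
    | succ n ih =>
      refine le_trans ?_ ih
      rw [Finset.sum_range_succ, add_comm (∑ k ∈ _, _), ← add_assoc,
        ← lintegral_add_left (measurable_jumpBound hw ρ b t (n + 1))]
      gcongr ?_ + _
      simpa using hA.lintegral_mul_jumpBound_le π x t n (H := fun _ => 1) measurable_const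
        fun _ _ _ => rfl
  calc ∫⁻ p, extState w (stateAt t p) ∂π.law x
      ≤ ∫⁻ p, ∑' n, sojournWeight w t n p ∂π.law x :=
        lintegral_mono fun p => extState_stateAt_le_tsum w t p
    _ = ∑' n, ∫⁻ p, sojournWeight w t n p ∂π.law x :=
        lintegral_tsum fun n => (measurable_sojournWeight hw t n).aemeasurable
    _ ≤ _ := ENNReal.tsum_le_of_sum_range_le fun n => le_add_self.trans (key n)

/-- Doob's maximal inequality for the supermartingale of jump bounds, stopped at the first state
with w > j: at that jump the bound is at least w, hence exceeds j. -/
theorem GrowthCondition.mul_measure_exit_le (hA : GrowthCondition 𝓜 w ρ b Sk)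
    (π : Policy 𝓜) (x : S) (t : ℝ≥0) (j : ℝ≥0) :
    j * π.law x (⋃ n, {p | jumpTime n p ≤ t ∧ j < extState w (jumpState n p)
        ∧ p ∈ sublevelPath w j n}) ≤ ENNReal.ofReal (growthBound ρ b t (w x)) := by
  have hw := hA.continuous_w.measurable
  have hw0 : ∀ y, 0 ≤ w y := fun y => zero_le_one.trans (hA.one_le_w y)
  set D : ℕ → Set (Path S) := fun n => {p | jumpTime n p ≤ t ∧ j < extState w (jumpState n p)
        ∧ p ∈ sublevelPath w j n} with hD
  have hDm : ∀ n, MeasurableSet (D n) := fun n =>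
    (measurable_jumpTime n measurableSet_Iic).inter
      ((((measurable_extState hw).comp (measurable_jumpState n)) measurableSet_Ioi).inter
        (measurableSet_sublevelPath hw j n))
  have hI : ∀ n, Measurable ((sublevelPath w j n).indicator (1 : Path S → ℝ≥0∞)) := fun n =>
    measurable_one.indicator (measurableSet_sublevelPath hw j n)
  -- A path still inside the level before index n either stays inside at n or exits there; in the
  -- latter case its bound pays for j.
  have hpt : ∀ n p, (sublevelPath w j (n + 1)).indicator 1 p * jumpBound w ρ b t n p
      + j * (D n).indicator 1 p ≤ (sublevelPath w j n).indicator 1 p * jumpBound w ρ b t n p := by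
    intro n p
    by_cases h1 : p ∈ sublevelPath w j (n + 1)
    · have h2 : p ∈ sublevelPath w j n := fun i hi => h1 i (by omega)
      have h3 : p ∉ D n := fun h => h.2.1.not_ge (h1 n (Nat.lt_succ_self n))
      simp [h1, h2, h3]
    · by_cases h3 : p ∈ D n
      · have h2 : p ∈ sublevelPath w j n := h3.2.2
        simp only [indicator_of_notMem h1, indicator_of_mem h3, indicator_of_mem h2, zero_mul,
          Pi.one_apply, mul_one, one_mul, zero_add]
        refine h3.2.1.le.trans ?_
        have hT : p ∈ {p : Path S | jumpTime n p ≤ t} := h3.1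
        rw [jumpBound, indicator_of_mem hT]
        rcases jumpState n p with y | y
        · refine ENNReal.ofReal_le_ofReal (le_growthBound hA.rho_nonneg hA.b_nonneg ?_ (hw0 y))
          have := ENNReal.toReal_mono ENNReal.coe_ne_top h3.1
          simpa using this
        · exact le_rfl
      · simp [h1, h3]
  have key : ∀ n, ∫⁻ p, (sublevelPath w j n).indicator 1 p * jumpBound w ρ b t n p ∂π.law x
      + ∑ k ∈ Finset.range n, j * π.law x (D k) ≤ ENNReal.ofReal (growthBound ρ b t (w x)) :=
    fun n => by
    induction n with
    | zero => simp [sublevelPath, hA.lintegral_jumpBound_zero π x t]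
    | succ n ih =>
      refine le_trans ?_ ih
      rw [Finset.sum_range_succ, add_comm (∑ k ∈ _, _), ← add_assoc]
      gcongr
      calc ∫⁻ p, (sublevelPath w j (n + 1)).indicator 1 p * jumpBound w ρ b t (n + 1) p ∂π.law x
            + j * π.law x (D n)
          ≤ ∫⁻ p, (sublevelPath w j (n + 1)).indicator 1 p * jumpBound w ρ b t n p ∂π.law x
            + j * π.law x (D n) := by
            gcongr ?_ + _
            refine le_trans ?_ (hA.lintegral_mul_jumpBound_le π x t n (hI (n + 1))
              fun p p' hp => indicator_sublevelPath_congr w j hp)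
            exact lintegral_mono fun p => mul_le_mul_right le_self_add _
        _ = ∫⁻ p, ((sublevelPath w j (n + 1)).indicator 1 p * jumpBound w ρ b t n p
            + j * (D n).indicator 1 p) ∂π.law x := by
            have hm : Measurable fun p =>
                (sublevelPath w j (n + 1)).indicator 1 p * jumpBound w ρ b t n p :=
              (hI _).mul (measurable_jumpBound hw ρ b t n)
            rw [lintegral_add_left hm,
              lintegral_const_mul _ (measurable_one.indicator (hDm n)),
              lintegral_indicator_one (hDm n)]
        _ ≤ _ := lintegral_mono (hpt n)
  calc j * π.law x (⋃ n, D n) ≤ j * ∑' n, π.law x (D n) := by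
        gcongr; exact measure_iUnion_le _
    _ = ∑' n, j * π.law x (D n) := ENNReal.tsum_mul_left.symm
    _ ≤ _ := ENNReal.tsum_le_of_sum_range_le fun n => le_add_self.trans (key n)

/-- The process does not explode. -/
theorem GrowthCondition.ae_exists_lt_jumpTime (hA : GrowthCondition 𝓜 w ρ b Sk)
    (π : Policy 𝓜) (x : S) (t : ℝ≥0) : ∀ᵐ p ∂π.law x, ∃ n, t < jumpTime n p := by
  have hw := hA.continuous_w.measurable
  have hbdd : ∀ j : ℝ≥0, π.law x (⋂ n, {p | jumpTime n p ≤ t ∧ p ∈ sublevelPath w j n}) = 0 := by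
    intro j
    obtain ⟨C', hC'⟩ := hA.exists_jumpRate_le j
    -- The added 1 makes C nonzero, so that 1/C is finite.
    set C : ℝ≥0 := C' + 1
    have hC0 : C ≠ 0 := by positivity
    have hC : ∀ x, w x ≤ j → ∀ a, 𝓜.jumpRate (Sum.inl x, a) univ ≤ C := fun y hy a =>
      (hC' y hy a).trans (by simp [C])
    set ε : ℝ≥0∞ := ENNReal.ofReal (Real.exp (-t)) with hε
    have hε0 : ε ≠ 0 := (ENNReal.ofReal_pos.2 (Real.exp_pos _)).ne'
    set P := π.law x (⋂ n, {p | jumpTime n p ≤ t ∧ p ∈ sublevelPath w j n})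
    -- On this event exp(-T_n) ≥ exp(-t) for every n, whereas its mean decays geometrically on paths
    -- staying in {w ≤ j}.
    have h1 : ∀ n : ℕ, n * ((C : ℝ≥0∞)⁻¹ * (ε * P)) ≤ 1 := fun n => by
      refine le_trans ?_ (π.lintegral_sublevelPath_jumpDiscount_le hw hC0 hC x t n)
      rw [← mul_assoc]
      gcongr
      · exact ENNReal.nat_mul_le_one_add_pow _ n
      have hEm : MeasurableSet {p : Path S | jumpTime n p ≤ t ∧ p ∈ sublevelPath w j n} :=
        (measurable_jumpTime n measurableSet_Iic).inter (measurableSet_sublevelPath hw j n)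
      calc ε * P ≤ ε * π.law x {p | jumpTime n p ≤ t ∧ p ∈ sublevelPath w j n} := by
            gcongr; exact measure_mono (iInter_subset _ n)
        _ = ∫⁻ p, ε * {p : Path S | jumpTime n p ≤ t ∧ p ∈ sublevelPath w j n}.indicator 1 p
            ∂π.law x := by
            rw [lintegral_const_mul _ (measurable_one.indicator hEm), lintegral_indicator_one hEm]
        _ ≤ _ := lintegral_mono fun p => by
            by_cases hp : p ∈ {p : Path S | jumpTime n p ≤ t ∧ p ∈ sublevelPath w j n}
            · have hT : p ∈ {p : Path S | jumpTime n p ≤ t} := hp.1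
              rw [indicator_of_mem hp, indicator_of_mem hp.2, jumpDiscount, indicator_of_mem hT]
              simp only [Pi.one_apply, mul_one, one_mul, hε]
              refine ENNReal.ofReal_le_ofReal (Real.exp_le_exp.2 (neg_le_neg ?_))
              have := ENNReal.toReal_mono ENNReal.coe_ne_top hp.1
              simpa using this
            · simp [hp]
    have h2 := ENNReal.eq_zero_of_forall_nat_mul_le ENNReal.one_ne_top h1
    simpa [hε0] using h2
  -- Up to a null set, infinitely many jumps by time t force an exit from {w ≤ j}. As j is
  -- arbitrary, the maximal inequality makes this event null.
  have hle : ∀ j : ℕ, j * π.law x {p | ∀ n, jumpTime n p ≤ t}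
      ≤ ENNReal.ofReal (growthBound ρ b t (w x)) := fun j => by
    refine le_trans ?_ (hA.mul_measure_exit_le π x t j)
    refine mul_le_mul' (by simp) ?_
    refine (measure_mono (t := (⋃ n, {p | jumpTime n p ≤ t ∧ ((j : ℝ≥0) : ℝ≥0∞) < extState w
      (jumpState n p) ∧ p ∈ sublevelPath w j n})
      ∪ ⋂ n, {p | jumpTime n p ≤ t ∧ p ∈ sublevelPath w j n}) fun p hp => ?_).trans
      ((measure_union_le _ _).trans (by rw [hbdd j, add_zero]))
    by_cases hex : ∃ n, ((j : ℝ≥0) : ℝ≥0∞) < extState w (jumpState n p)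
    · classical
      refine Or.inl (mem_iUnion.2 ⟨Nat.find hex, hp _, Nat.find_spec hex, fun i hi => ?_⟩)
      exact not_lt.1 (Nat.find_min hex hi)
    · push Not at hex
      exact Or.inr (mem_iInter.2 fun n => ⟨hp n, fun i _ => hex i⟩)
  have h0 := ENNReal.eq_zero_of_forall_nat_mul_le ENNReal.ofReal_ne_top hle
  filter_upwards [measure_eq_zero_iff_ae_notMem.1 h0] with p hp
  simpa using hp

end Moments

/-! ### The state just before t, and joint measurability -/

section States

variable {S A : Type*}

/-- Without a jump at t the intervals (T_k, T_{k+1}] and [T_k, T_{k+1}) containing t have the same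
index. Time 0 is separate: there both states are X_0, by the convention for ξ_{0-} and because T_1 >
0. -/
theorem stateBefore_eq_stateAt {t : ℝ≥0} {p : Path S} (h : ∀ n, jumpTime (n + 1) p ≠ t) :
    stateBefore t p = stateAt t p := by
  classical
  unfold stateBefore stateAt
  by_cases ht : t = 0
  · subst ht
    have h0 : jumpTime 0 p ≤ ((0 : ℝ≥0) : ℝ≥0∞) ∧ ((0 : ℝ≥0) : ℝ≥0∞) < jumpTime (0 + 1) p := by
      refine ⟨by simp [jumpTime], ?_⟩
      rw [jumpTime_succ]
      exact (sojourn_pos 0 p).trans_le le_add_self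
    have hex : ∃ k, jumpTime k p ≤ ((0 : ℝ≥0) : ℝ≥0∞)
        ∧ ((0 : ℝ≥0) : ℝ≥0∞) < jumpTime (k + 1) p := ⟨0, h0⟩
    rw [if_pos rfl, dif_pos hex, (Nat.find_eq_zero hex).2 h0]
  · have h' : ∀ n, jumpTime n p ≠ t := fun n => by
      cases n with
      | zero =>
        simpa [jumpTime] using fun h => ht (by exact_mod_cast h.symm)
      | succ n => exact h n
    have hiff : (fun k => jumpTime k p < t ∧ t ≤ jumpTime (k + 1) p)
        = fun k => jumpTime k p ≤ t ∧ t < jumpTime (k + 1) p := by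
      funext k
      rw [lt_iff_le_and_ne (a := jumpTime k p), lt_iff_le_and_ne (b := jumpTime (k + 1) p)]
      simp [h' k, (h' (k + 1)).symm]
    rw [if_neg ht]
    by_cases hex : ∃ k, jumpTime k p ≤ t ∧ t < jumpTime (k + 1) p
    · have hex' : ∃ k, jumpTime k p < t ∧ t ≤ jumpTime (k + 1) p := by
        obtain ⟨k, hk⟩ := hex
        exact ⟨k, (congrFun hiff k).mpr hk⟩
      rw [dif_pos hex, dif_pos hex']
      congr 1
      exact Nat.find_congr' fun {k} => iff_of_eq (congrFun hiff k)
    · have hex' : ¬ ∃ k, jumpTime k p < t ∧ t ≤ jumpTime (k + 1) p := by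
        rintro ⟨k, hk⟩
        exact hex ⟨k, (congrFun hiff k).mp hk⟩
      rw [dif_neg hex, dif_neg hex']

theorem exists_stateAt_eq_inl {t : ℝ≥0} {p : Path S} (h : ∃ n, t < jumpTime n p) :
    ∃ x, stateAt t p = Sum.inl x := by
  classical
  have hn := Nat.find_spec h
  obtain ⟨k, hk⟩ : ∃ k, Nat.find h = k + 1 := by
    refine Nat.exists_eq_succ_of_ne_zero fun h0 => ?_
    rw [h0] at hn
    simp [jumpTime] at hn
  have hex : ∃ k, jumpTime k p ≤ t ∧ t < jumpTime (k + 1) p :=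
    ⟨k, not_lt.1 (Nat.find_min h (by omega)), hk ▸ hn⟩
  unfold stateAt
  rw [dif_pos hex]
  exact exists_jumpState_eq_inl ((Nat.find_spec hex).1.trans_lt ENNReal.coe_lt_top).ne

variable [MeasurableSpace S] [MeasurableSpace A] {N : ℕ}

theorem measurable_stateBefore :
    Measurable fun z : Path S × ℝ≥0 => stateBefore z.2 z.1 := by
  classical
  have hP : ∀ k, MeasurableSet {z : Path S × ℝ≥0 |
      jumpTime k z.1 < z.2 ∧ z.2 ≤ jumpTime (k + 1) z.1} := fun k =>
    (measurableSet_lt ((measurable_jumpTime k).comp measurable_fst)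
      measurable_snd.coe_nnreal_ennreal).inter
    (measurableSet_le measurable_snd.coe_nnreal_ennreal
      ((measurable_jumpTime (k + 1)).comp measurable_fst))
  have hQ : MeasurableSet {z : Path S × ℝ≥0 |
      ∃ k, jumpTime k z.1 < z.2 ∧ z.2 ≤ jumpTime (k + 1) z.1} := by
    rw [ofPred_exists]
    exact MeasurableSet.iUnion hP
  -- `Measurable.find` needs a predicate that always has a witness; the second alternative supplies
  -- k = 0 when no sojourn interval contains the time.
  have hex : ∀ z : Path S × ℝ≥0, ∃ k, (jumpTime k z.1 < z.2 ∧ z.2 ≤ jumpTime (k + 1) z.1)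
      ∨ ¬ ∃ k, jumpTime k z.1 < z.2 ∧ z.2 ≤ jumpTime (k + 1) z.1 := fun z => by
    by_cases h : ∃ k, jumpTime k z.1 < z.2 ∧ z.2 ≤ jumpTime (k + 1) z.1
    · obtain ⟨k, hk⟩ := h; exact ⟨k, Or.inl hk⟩
    · exact ⟨0, Or.inr h⟩
  have hf : ∀ k, Measurable fun z : Path S × ℝ≥0 =>
      if jumpTime k z.1 < z.2 ∧ z.2 ≤ jumpTime (k + 1) z.1 then jumpState k z.1
      else Sum.inr () := fun k =>
    Measurable.ite (hP k) ((measurable_jumpState k).comp measurable_fst) measurable_const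
  have hfind := Measurable.find (p := fun k (z : Path S × ℝ≥0) =>
      (jumpTime k z.1 < z.2 ∧ z.2 ≤ jumpTime (k + 1) z.1)
      ∨ ¬ ∃ k, jumpTime k z.1 < z.2 ∧ z.2 ≤ jumpTime (k + 1) z.1) hf (fun k => (hP k).union hQ.compl) hex
  have heq : (fun z : Path S × ℝ≥0 => stateBefore z.2 z.1) = fun z =>
      if z.2 = 0 then jumpState 0 z.1 else
        if jumpTime (Nat.find (hex z)) z.1 < z.2 ∧ z.2 ≤ jumpTime (Nat.find (hex z) + 1) z.1 then
          jumpState (Nat.find (hex z)) z.1 else Sum.inr () := by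
    funext z
    unfold stateBefore
    by_cases h : ∃ k, jumpTime k z.1 < z.2 ∧ z.2 ≤ jumpTime (k + 1) z.1
    · have hfe : Nat.find (hex z) = Nat.find h :=
        Nat.find_congr' fun {k} => ⟨fun hk => hk.resolve_right (not_not.2 h), Or.inl⟩
      have hs := Nat.find_spec h
      rw [← hfe] at hs
      rw [dif_pos h, if_pos hs]
      congr 2
      exact hfe.symm
    · rw [dif_neg h, if_neg fun hk => h ⟨_, hk⟩]
  rw [heq]
  exact Measurable.ite (measurable_snd (measurableSet_singleton 0))
    ((measurable_jumpState 0).comp measurable_fst) hfind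

/-- The policy as a kernel on `Ω × [0, ∞)`. -/
noncomputable def Policy.actKernel {𝓜 : Model S A N} (π : Policy 𝓜) :
    Kernel (Path S × ℝ≥0) (A ⊕ Unit) where
  toFun z := π.act z.1 z.2
  measurable' := Measure.measurable_of_measurable_coe _ fun B hB =>
    (π.predictable_act B hB).mono predictable_le le_rfl

instance {𝓜 : Model S A N} (π : Policy 𝓜) : IsMarkovKernel π.actKernel :=
  ⟨fun _ => π.isProbabilityMeasure_act _ _⟩

theorem Model.measurable_cost (𝓜 : Model S A N) (n : Fin (N + 1)) : Measurable (𝓜.cost n) := by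
  refine Fin.cases ?_ (fun n => ?_) n
  · exact 𝓜.measurable_r.neg
  · exact 𝓜.measurable_c n

theorem Model.measurable_extendZero (𝓜 : Model S A N) {u : 𝓜.K → ℝ} (hu : Measurable u) :
    Measurable (𝓜.extendZero u) :=
  𝓜.measurableEmbedding_incl.measurable_extend hu measurable_const

theorem CostCondition.abs_extendZero_le [StandardBorelSpace S] {𝓜 : Model S A N} {w : S → ℝ}
    {ρ M α : ℝ} {γ : Measure S} (hB : CostCondition 𝓜 w ρ M α γ) (n : Fin (N + 1))
    (y : S ⊕ Unit) (a : A ⊕ Unit) :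
    ENNReal.ofReal |𝓜.extendZero (𝓜.cost n) (y, a)| ≤ ENNReal.ofReal M * extState w y := by
  by_cases h : (y, a) ∈ range 𝓜.incl
  · obtain ⟨z, hz⟩ := h
    have hy : y = Sum.inl z.1.1 := (congrArg Prod.fst hz).symm
    have he : 𝓜.extendZero (𝓜.cost n) (y, a) = 𝓜.cost n z := by
      rw [← hz]; exact 𝓜.measurableEmbedding_incl.injective.extend_apply _ _ z
    rw [he, hy, extState, Sum.elim_inl, ← ENNReal.ofReal_mul hB.M_pos.le]
    exact ENNReal.ofReal_le_ofReal (hB.abs_cost_le n z)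
  · have he : 𝓜.extendZero (𝓜.cost n) (y, a) = 0 := Function.extend_apply' _ _ _ h
    simp [he]

variable {𝓜 : Model S A N}

theorem Policy.measurable_running (π : Policy 𝓜) {u : 𝓜.K → ℝ} (hu : Measurable u) :
    Measurable fun z : Path S × ℝ≥0 => π.running u z.2 z.1 := by
  have h : StronglyMeasurable (Function.uncurry fun (z : Path S × ℝ≥0) (a : A ⊕ Unit) =>
      𝓜.extendZero u (stateBefore z.2 z.1, a)) :=
    ((𝓜.measurable_extendZero hu).comp
      ((measurable_stateBefore.comp measurable_fst).prodMk measurable_snd)).stronglyMeasurable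
  exact (h.integral_kernel_prod_right (κ := π.actKernel)).measurable

variable [StandardBorelSpace S]

theorem Policy.measurable_integral_running (π : Policy 𝓜) {u : 𝓜.K → ℝ} (hu : Measurable u) :
    Measurable fun z : S × ℝ => ∫ e, π.running u z.2.toNNReal e ∂π.law z.1 := by
  have h : StronglyMeasurable (Function.uncurry fun (z : S × ℝ) (e : Path S) =>
      π.running u z.2.toNNReal e) :=
    ((π.measurable_running hu).comp
      (measurable_snd.prodMk (measurable_snd.comp measurable_fst).real_toNNReal)).stronglyMeasurable
  exact (h.integral_kernel_prod_right (κ := π.law.comap Prod.fst measurable_fst)).measurable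

theorem Policy.measurable_value (π : Policy 𝓜) (α : ℝ) {u : 𝓜.K → ℝ} (hu : Measurable u) :
    Measurable (π.value α u) := by
  have h : StronglyMeasurable (Function.uncurry fun (x : S) (t : ℝ) =>
      Real.exp (-α * t) * ∫ e, π.running u t.toNNReal e ∂π.law x) :=
    (Measurable.mul (by fun_prop) (π.measurable_integral_running hu)).stronglyMeasurable
  exact h.integral_prod_right.measurable

end States

/-! ### Discounting the growth bound -/

section Discount

/-- A crude bound that also covers ρ = 0, where the closed form of the integral would divide by ρ;
it suffices for the decay after discounting. -/
theorem integral_exp_le {ρ t : ℝ} (hρ : 0 ≤ ρ) (ht : 0 ≤ t) :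
    ∫ s in (0 : ℝ)..t, Real.exp (ρ * s) ≤ t * Real.exp (ρ * t) := by
  have hc : Continuous fun s => Real.exp (ρ * s) := by fun_prop
  have := intervalIntegral.integral_mono_on ht (hc.intervalIntegrable 0 t)
    (intervalIntegrable_const (μ := volume) (c := Real.exp (ρ * t))) fun s hs =>
      Real.exp_le_exp.2 (mul_le_mul_of_nonneg_left hs.2 hρ)
  simpa using this

/-- The Laplace transform of `growthBound`. -/
theorem integral_exp_mul_growthBound {ρ b α W : ℝ} (hρ : 0 ≤ ρ) (hb : 0 ≤ b) (hα : ρ < α)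
    (hW : 0 ≤ W) :
    IntegrableOn (fun t => Real.exp (-α * t) * growthBound ρ b t W) (Ioi 0) ∧
    ∫ t in Ioi (0 : ℝ), Real.exp (-α * t) * growthBound ρ b t W
      = (α * W + b) / (α * (α - ρ)) := by
  have hα0 : 0 < α := hρ.trans_lt hα
  have hd : 0 < α - ρ := sub_pos.2 hα
  set I : ℝ → ℝ := fun t => ∫ s in (0 : ℝ)..t, Real.exp (ρ * s) with hI
  -- An antiderivative of the discounted bound, from integrating the b-term by parts. It tends to 0
  -- at infinity and equals -(αW + b)/(α(α - ρ)) at 0.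
  set H : ℝ → ℝ := fun t => -((W + b / α) / (α - ρ)) * Real.exp (-(α - ρ) * t)
    - b / α * (Real.exp (-α * t) * I t) with hH
  have hexp : ∀ t, Real.exp (-(α - ρ) * t) = Real.exp (-α * t) * Real.exp (ρ * t) := fun t => by
    rw [← Real.exp_add]; ring_nf
  have hderiv : ∀ t, HasDerivAt H (Real.exp (-α * t) * growthBound ρ b t W) t := fun t => by
    have h1 : HasDerivAt (fun t => Real.exp (-(α - ρ) * t))
        (Real.exp (-(α - ρ) * t) * (-(α - ρ) * 1)) t := ((hasDerivAt_id t).const_mul _).exp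
    have h2 : HasDerivAt (fun t => Real.exp (-α * t)) (Real.exp (-α * t) * (-α * 1)) t :=
      ((hasDerivAt_id t).const_mul _).exp
    have h3 := (h1.const_mul (-((W + b / α) / (α - ρ)))).sub
      ((h2.mul (hasDerivAt_integral_exp ρ t)).const_mul (b / α))
    convert! h3 using 1
    rw [hexp, growthBound]
    field_simp
    ring
  have hlim : Tendsto H atTop (𝓝 0) := by
    have e1 : Tendsto (fun t => Real.exp (-(α - ρ) * t)) atTop (𝓝 0) :=
      Real.tendsto_exp_atBot.comp (tendsto_id.const_mul_atTop_of_neg (by linarith))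
    have e2 : Tendsto (fun t => t * Real.exp (-(α - ρ) * t)) atTop (𝓝 0) := by
      have := Real.tendsto_pow_mul_exp_neg_atTop_nhds_zero 1
      have h4 := (this.comp (tendsto_id.const_mul_atTop hd)).const_mul (α - ρ)⁻¹
      rw [mul_zero] at h4
      refine h4.congr fun t => ?_
      simp only [Function.comp_apply, id, pow_one, neg_mul]
      field_simp
    have e3 : Tendsto (fun t => Real.exp (-α * t) * I t) atTop (𝓝 0) := by
      refine tendsto_of_tendsto_of_tendsto_of_le_of_le' tendsto_const_nhds e2 ?_ ?_
      · filter_upwards [eventually_ge_atTop 0] with t ht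
        exact mul_nonneg (Real.exp_pos _).le (integral_exp_nonneg ht)
      · filter_upwards [eventually_ge_atTop 0] with t ht
        rw [hexp, mul_left_comm]
        exact mul_le_mul_of_nonneg_left (integral_exp_le hρ ht) (Real.exp_pos _).le
    simpa [hH] using (e1.const_mul (-((W + b / α) / (α - ρ)))).sub (e3.const_mul (b / α))
  have hpos : ∀ t ∈ Ioi (0 : ℝ), 0 ≤ Real.exp (-α * t) * growthBound ρ b t W := fun t ht =>
    mul_nonneg (Real.exp_pos _).le (growthBound_nonneg hb (le_of_lt ht) hW)
  -- As the integrand is nonnegative, convergence of its antiderivative already gives integrability.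
  refine ⟨integrableOn_Ioi_deriv_of_nonneg' (fun t _ => hderiv t) hpos hlim, ?_⟩
  rw [integral_Ioi_of_hasDerivAt_of_nonneg' (fun t _ => hderiv t) hpos hlim]
  simp only [hH, hI, mul_zero, Real.exp_zero, intervalIntegral.integral_same]
  field_simp
  ring

end Discount

/-! ### Admissibility and finiteness of the values -/

section Values

variable {S A : Type*} [MeasurableSpace S] [MeasurableSpace A] {N : ℕ} [StandardBorelSpace S]
  {𝓜 : Model S A N}

theorem Policy.ae_stateBefore_eq (π : Policy 𝓜) (x : S) (t : ℝ≥0) :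
    ∀ᵐ e ∂π.law x, stateBefore t e = stateAt t e := by
  filter_upwards [ae_all_iff.2 fun n => π.ae_jumpTime_ne x t n] with e he
  exact stateBefore_eq_stateAt he

theorem CostCondition.enorm_running_le {w : S → ℝ} {ρ M α : ℝ} {γ : Measure S}
    (hB : CostCondition 𝓜 w ρ M α γ) (π : Policy 𝓜)
    (n : Fin (N + 1)) (t : ℝ≥0) (e : Path S) :
    ‖π.running (𝓜.cost n) t e‖ₑ ≤ ENNReal.ofReal M * extState w (stateBefore t e) := by
  refine (enorm_integral_le_lintegral_enorm _).trans ?_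
  refine (lintegral_mono fun a => ?_).trans_eq
    ((lintegral_const _).trans (by rw [measure_univ, mul_one]))
  rw [Real.enorm_eq_ofReal_abs]
  exact hB.abs_extendZero_le n _ a

variable [TopologicalSpace S] [BorelSpace S] {w : S → ℝ} {ρ b M α : ℝ} {Sk : ℕ → Set S}
  {γ : Measure S}

/-- Policies are admissible at ξ_{t-}. Almost surely this equals ξ_t, and nonexplosion places ξ_t in
S, where the admissible actions are genuine ones. -/
theorem GrowthCondition.ae_mem_range_incl (hA : GrowthCondition 𝓜 w ρ b Sk) (π : Policy 𝓜)
    (x : S) (t : ℝ≥0) :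
    ∀ᵐ e ∂π.law x, ∀ᵐ a ∂π.act e t, (stateAt t e, a) ∈ range 𝓜.incl := by
  filter_upwards [π.ae_stateBefore_eq x t, hA.ae_exists_lt_jumpTime π x t] with e he hex
  obtain ⟨y, hy⟩ := exists_stateAt_eq_inl hex
  have h1 := π.act_adm e t
  rw [he, hy] at h1
  have hm : MeasurableSet (𝓜.admInfty (Sum.inl y)) :=
    measurableSet_inl_image.2 (𝓜.measurableSet_adm y)
  have h2 : ∀ᵐ a ∂π.act e t, a ∈ 𝓜.admInfty (Sum.inl y) :=
    (mem_ae_iff_prob_eq_one hm).2 h1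
  filter_upwards [h2] with a ha
  obtain ⟨a, ha, rfl⟩ := ha
  exact ⟨⟨(y, a), ha⟩, by rw [hy]; rfl⟩

/-- The running cost is read at ξ_{t-}, the moment bound at ξ_t; their almost sure equality connects
the two. -/
theorem CostCondition.lintegral_enorm_running_le (hB : CostCondition 𝓜 w ρ M α γ)
    (hA : GrowthCondition 𝓜 w ρ b Sk) (π : Policy 𝓜) (n : Fin (N + 1)) (x : S) (t : ℝ≥0) :
    ∫⁻ e, ‖π.running (𝓜.cost n) t e‖ₑ ∂π.law x
      ≤ ENNReal.ofReal (M * growthBound ρ b t (w x)) := by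
  calc ∫⁻ e, ‖π.running (𝓜.cost n) t e‖ₑ ∂π.law x
      ≤ ∫⁻ e, ENNReal.ofReal M * extState w (stateAt t e) ∂π.law x := by
        refine lintegral_mono_ae ?_
        filter_upwards [π.ae_stateBefore_eq x t] with e he
        rw [← he]
        exact hB.enorm_running_le π n t e
    _ = ENNReal.ofReal M * ∫⁻ e, extState w (stateAt t e) ∂π.law x :=
        lintegral_const_mul' _ _ ENNReal.ofReal_ne_top
    _ ≤ ENNReal.ofReal M * ENNReal.ofReal (growthBound ρ b t (w x)) := by
        gcongr; exact hA.lintegral_stateAt_le π x t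
    _ = _ := (ENNReal.ofReal_mul hB.M_pos.le).symm

theorem CostCondition.integrable_running (hB : CostCondition 𝓜 w ρ M α γ)
    (hA : GrowthCondition 𝓜 w ρ b Sk) (π : Policy 𝓜) (n : Fin (N + 1)) (x : S) (t : ℝ≥0) :
    Integrable (fun e => π.running (𝓜.cost n) t e) (π.law x) :=
  ⟨((π.measurable_running (𝓜.measurable_cost n)).comp
      measurable_prodMk_right).aestronglyMeasurable,
    (hB.lintegral_enorm_running_le hA π n x t).trans_lt ENNReal.ofReal_lt_top⟩

theorem CostCondition.norm_discounted_le (hB : CostCondition 𝓜 w ρ M α γ)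
    (hA : GrowthCondition 𝓜 w ρ b Sk) (π : Policy 𝓜) (n : Fin (N + 1)) (x : S) {t : ℝ}
    (ht : 0 < t) :
    ‖Real.exp (-α * t) * ∫ e, π.running (𝓜.cost n) t.toNNReal e ∂π.law x‖
      ≤ M * (Real.exp (-α * t) * growthBound ρ b t (w x)) := by
  have hw0 : 0 ≤ w x := zero_le_one.trans (hA.one_le_w x)
  have hg0 : 0 ≤ M * growthBound ρ b t (w x) :=
    mul_nonneg hB.M_pos.le (growthBound_nonneg hA.b_nonneg ht.le hw0)
  have h1 := (enorm_integral_le_lintegral_enorm _).trans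
    (hB.lintegral_enorm_running_le hA π n x t.toNNReal)
  rw [Real.coe_toNNReal _ ht.le, Real.enorm_eq_ofReal_abs, ENNReal.ofReal_le_ofReal_iff hg0] at h1
  rw [norm_mul, Real.norm_of_nonneg (Real.exp_pos _).le, mul_left_comm]
  exact mul_le_mul_of_nonneg_left h1 (Real.exp_pos _).le

theorem CostCondition.valueFinite (hB : CostCondition 𝓜 w ρ M α γ)
    (hA : GrowthCondition 𝓜 w ρ b Sk) (π : Policy 𝓜) (n : Fin (N + 1)) (x : S) :
    π.ValueFinite α (𝓜.cost n) x where
  action t e := by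
    refine ⟨((𝓜.measurable_extendZero (𝓜.measurable_cost n)).comp
      measurable_prodMk_left).aestronglyMeasurable, ?_⟩
    refine (lintegral_mono fun a => ?_).trans_lt
      (b := ∫⁻ _, ENNReal.ofReal M * extState w (stateBefore t e) ∂π.act e t) ?_
    · rw [Real.enorm_eq_ofReal_abs]
      exact hB.abs_extendZero_le n _ a
    -- For a fixed path and time the cost bound is constant in the action, so integrability in the
    -- action holds everywhere, not just almost surely.
    · rw [lintegral_const, measure_univ, mul_one]
      refine ENNReal.mul_lt_top ENNReal.ofReal_lt_top ?_
      rcases stateBefore t e with y | y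
      · exact ENNReal.ofReal_lt_top
      · exact ENNReal.zero_lt_top
  path t := hB.integrable_running hA π n x t
  time := by
    have hw0 : 0 ≤ w x := zero_le_one.trans (hA.one_le_w x)
    have hg := (integral_exp_mul_growthBound hA.rho_nonneg hA.b_nonneg hB.rho_lt hw0).1
    refine Integrable.mono' (hg.const_mul M) ?_ ?_
    · exact (Measurable.mul (by fun_prop) ((π.measurable_integral_running
        (𝓜.measurable_cost n)).comp measurable_prodMk_left)).aestronglyMeasurable
    · exact (ae_restrict_iff' measurableSet_Ioi).2
        (ae_of_all _ fun t ht => hB.norm_discounted_le hA π n x ht)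

theorem CostCondition.abs_value_le (hB : CostCondition 𝓜 w ρ M α γ)
    (hA : GrowthCondition 𝓜 w ρ b Sk) (π : Policy 𝓜) (n : Fin (N + 1)) (x : S) :
    |π.value α (𝓜.cost n) x| ≤ M * (α * w x + b) / (α * (α - ρ)) := by
  have hw0 : 0 ≤ w x := zero_le_one.trans (hA.one_le_w x)
  have hg := integral_exp_mul_growthBound hA.rho_nonneg hA.b_nonneg hB.rho_lt hw0
  rw [mul_div_assoc, ← hg.2, ← integral_const_mul]
  exact norm_integral_le_of_norm_le (hg.1.const_mul M) ((ae_restrict_iff' measurableSet_Ioi).2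
    (ae_of_all _ fun t ht => hB.norm_discounted_le hA π n x ht))

theorem CostCondition.integrable_value [IsProbabilityMeasure γ]
    (hB : CostCondition 𝓜 w ρ M α γ) (hA : GrowthCondition 𝓜 w ρ b Sk) (π : Policy 𝓜)
    (n : Fin (N + 1)) :
    Integrable (π.value α (𝓜.cost n)) γ ∧
      |π.totalValue α γ (𝓜.cost n)| ≤ M * ((α * ∫ x, w x ∂γ + b) / (α * (α - ρ))) := by
  have hi : Integrable (fun x => M * (α * w x + b) / (α * (α - ρ))) γ :=
    (((hB.integrable_w.const_mul α).add (integrable_const b)).const_mul M).div_const _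
  have hle : ∀ᵐ x ∂γ, ‖π.value α (𝓜.cost n) x‖ ≤ M * (α * w x + b) / (α * (α - ρ)) :=
    ae_of_all _ fun x => hB.abs_value_le hA π n x
  refine ⟨hi.mono' (π.measurable_value α (𝓜.measurable_cost n)).aestronglyMeasurable hle, ?_⟩
  refine (norm_integral_le_of_norm_le hi hle).trans_eq ?_
  rw [integral_div, integral_const_mul,
    integral_add (hB.integrable_w.const_mul α) (integrable_const b), integral_const_mul,
    integral_const, probReal_univ, one_smul, mul_div_assoc]

end Values

end CTMDP

theorem theoremt3 {S : Type*} {A : Type*}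
    [TopologicalSpace S] [PolishSpace S] [MeasurableSpace S] [BorelSpace S]
    [TopologicalSpace A] [PolishSpace A] [MeasurableSpace A] [BorelSpace A]
    {N : ℕ} (𝓜 : CTMDP.Model S A N)
    (w : S → ℝ) (ρ b : ℝ) (Sk : ℕ → Set S) (M α : ℝ)
    (γ : Measure S) [IsProbabilityMeasure γ]
    (hA : CTMDP.GrowthCondition 𝓜 w ρ b Sk)
    (hB : CTMDP.CostCondition 𝓜 w ρ M α γ)
    (π : CTMDP.Policy 𝓜) :
    (∀ (x : S) (t : ℝ≥0),
      (∀ᵐ e ∂π.law x, ∀ᵐ a ∂π.act e t, (CTMDP.stateAt t e, a) ∈ range 𝓜.incl) ∧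
      ∫⁻ e, CTMDP.extState w (CTMDP.stateAt t e) ∂π.law x < ∞ ∧
      ∀ n : Fin (N + 1),
        ∫⁻ e, ∫⁻ a, ENNReal.ofReal |𝓜.extendZero (𝓜.cost n) (CTMDP.stateAt t e, a)|
            ∂π.act e t ∂π.law x
          ≤ ENNReal.ofReal M * ∫⁻ e, CTMDP.extState w (CTMDP.stateAt t e) ∂π.law x) ∧
    (∀ (x : S) (n : Fin (N + 1)),
      π.ValueFinite α (𝓜.cost n) x ∧
      |π.value α (𝓜.cost n) x| ≤ M * (α * w x + b) / (α * (α - ρ))) ∧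
    (∀ n : Fin (N + 1),
      Integrable (π.value α (𝓜.cost n)) γ ∧
      |π.totalValue α γ (𝓜.cost n)| ≤ M * ((α * ∫ x, w x ∂γ + b) / (α * (α - ρ)))) := by
  refine ⟨fun x t => ⟨hA.ae_mem_range_incl π x t,
    (hA.lintegral_stateAt_le π x t).trans_lt ENNReal.ofReal_lt_top, fun n => ?_⟩,
    fun x n => ⟨hB.valueFinite hA π n x, hB.abs_value_le hA π n x⟩,
    fun n => hB.integrable_value hA π n⟩
  rw [← lintegral_const_mul' _ _ ENNReal.ofReal_ne_top]
  -- The cost bound holds for every pair in the extended spaces, because costs are extended by 0; no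
  -- exceptional null set is needed here.
  refine lintegral_mono fun e => ?_
  exact (lintegral_mono fun a => hB.abs_extendZero_le n _ a).trans_eq
    ((lintegral_const _).trans (by rw [measure_univ, mul_one]))
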